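/- Conventions. Multigraphs are finite, undirected and loopless, with multiple edges allowed. For $k\ge 0$ let $\mathcal G_k$ be the commutative monoid of isomorphism classes of $k$-labeled multigraphs ($k$ distinct vertices carry the labels $1,\dots,k$, isomorphisms respect labels), where the product is disjoint union followed by identification of equally labeled vertices (edge multiplicities add). Let $\mathcal A_k=\mathbb R[\mathcal G_k]$ be its monoid algebra and $\mathcal A_k^0\subseteq\mathcal A_k$ the subalgebra spanned by the graphs without unlabeled vertices; for $i\neq j$ let $z_{ij}\in\mathcal A_k^0$ be the graph whose only edge joins $i$ and $j$. Elements of $\mathcal A_0$ are called quantum multigraphs. An $a\in\mathcal A_0$ and a $\sigma\in\mathcal A_k$ \emph{coincide up to labels and isolated vertices} if they become equal after forgetting labels and identifying each graph $F$ with $F\sqcup K_1$. For a commutative ring $A$ and $r_1,\dots,r_m\in A$, $\mathrm{PO}(r_1,\dots,r_m)$ is the set of all $\sum_{e\in\{0,1\}^m}\sigma_e r_1^{e_1}\cdots r_m^{e_m}$ with each $\sigma_e$ a sum of squares in $A$; put $\mathcal P_k(d)=\mathrm{PO}(d\pm z_{ij}\mid i<j)\subseteq\mathcal A_k^0$. A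 graph parameter is a map $t:\mathcal G_0\to\mathbb R$, extended linearly to all $\mathcal A_k$ by ignoring labels. It is isolate indifferent if $t(F\sqcup K_1)=t(F)$ for all $F$, flatly reflection positive if $t(b^2)\ge 0$ for all $k$ and $b\in\mathcal A_k^0$, and $d$-bounded if $|t(K_2^m)|\le d^m$ for all $m\ge 0$, where $K_2^m$ has two vertices and $m$ edges between them. For $n\ge1$, $g=\sum_{i=1}^n x_i$, and a multigraph $F$ put $$\tilde t(F,n)=g^{-|V_F|}\sum_{\varphi:V_F\to[n]}\ \prod_{v\in V_F}x_{\varphi(v)}\prod_{vw\in E_F}y_{\varphi(v)\varphi(w)}\in\mathbb R[x_i,y_{ij}\mid 1\le i\le j\le n][g^{-1}]$$ (edges counted with multiplicity, $y_{ij}=y_{ji}$), and extend linearly to $\mathcal A_0$. Let $a=K_2^6+T-2P\in\mathcal A_0$ be the Robinson quantum multigraph, where $T$ is the triangle with all edges doubled and $P$ is the path on three vertices whose two edges have multiplicities $4$ and $2$. Let $$R=z_{12}^6+z_{13}^6+z_{23}^6-(z_{12}^4z_{13}^2+z_{12}^4z_{23}^2+z_{12}^2z_{13}^4+z_{13}^4z_{23}^2+z_{12}^2z_{23}^4+z_{13}^2z_{23}^4)+3z_{12}^2z_{13}^2z_{23}^2$$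 be the Robinson polynomial, regarded both as a polynomial in three variables and as an element of $\mathcal A_3^0$. Theorem. (1) $3a$ and $R\in\mathcal A_3^0$ coincide up to labels and isolated vertices. The polynomial $R$ is nonnegative on $\mathbb R^3$ but is not a sum of squares of real polynomials. (2) For all real $d>0$ and $\epsilon>0$ one has $R+\epsilon\in\mathcal P_3(d)$. For every real $d>0$, $t(a)\ge 0$ for each isolate indifferent, flatly reflection positive, $d$-bounded graph parameter $t$. (3) For every real $d>0$ and every $k\ge 0$, $a$ does not coincide up to labels and isolated vertices with any element of $\mathrm{PO}(d\pm z_{ij}\mid 1\le i<j\le k)\subseteq\mathcal A_k$, and hence with no element of $\mathcal P_k(d)\subseteq\mathcal A_k^0$. Moreover, substituting $x_i=1/3$ and $y_{ii}=0$ in $\tilde t(a,3)$ gives a positive multiple of $R$ (in the variables $y_{ij}$), and for every $d>0$, $R\notin\mathrm{PO}(d\pm y_{12},d\pm y_{13},d\pm y_{23})\subseteq\mathbb R[y_{12},y_{13},y_{23}]$. (4) Reducing all edge multiplicities in $a$ to one gives the simple quantum graph $b=K_3-2P_3+K_2$, where $P_3$ is the path on three vertices. For every finite nonempty simple graph $G$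 one has $t(b,G)\ge 0$, and also $t(c,G)\ge 0$ for $c=K_3-2(K_2\sqcup K_2)+K_2$ (Goodman's theorem), where $t(\cdot,G)$ is the linear extension of the homomorphism density $t(F,G)=\hom(F,G)/|V_G|^{|V_F|}$. -/

import Mathlib

noncomputable section

namespace QMG

/-! ## Labeled multigraphs -/

/-- A `k`-labeled finite loopless multigraph.  The vertex set is `Fin k ⊕ U`: the vertices in
`Fin k` are the labeled ones (label = index), `U` is the finite type of unlabeled vertices.
The edges form a multiset of unordered pairs of distinct vertices; the multiplicity of an edge
is its multiplicity in that multiset. -/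
structure LabeledMultigraph (k : ℕ) where
  U : Type
  [fintypeU : Fintype U]
  edges : Multiset (Sym2 (Fin k ⊕ U))
  loopless : ∀ e ∈ edges, ¬ e.IsDiag

attribute [instance] LabeledMultigraph.fintypeU

namespace LabeledMultigraph

variable {k : ℕ}

/-- The full vertex set. -/
abbrev V (F : LabeledMultigraph k) : Type := Fin k ⊕ F.U

/-- Isomorphism of `k`-labeled multigraphs: a bijection of the vertices which fixes the labels
and carries the edges of `F` to those of `G`, with multiplicities. -/
def Iso (F G : LabeledMultigraph k) : Prop :=
  ∃ σ : F.U ≃ G.U, F.edges.map (Sym2.map (Sum.map id σ)) = G.edges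

theorem Iso.refl (F : LabeledMultigraph k) : Iso F F :=
  ⟨Equiv.refl _, by simp⟩

theorem Iso.symm {F G : LabeledMultigraph k} (h : Iso F G) : Iso G F := by
  obtain ⟨σ, hσ⟩ := h
  refine ⟨σ.symm, ?_⟩
  rw [← hσ, Multiset.map_map]
  conv_rhs => rw [← Multiset.map_id F.edges]
  refine Multiset.map_congr rfl fun e _ => ?_
  induction e using Sym2.ind with | _ a b => ?_
  rcases a with a | a <;> rcases b with b | b <;> simp

theorem Iso.trans {F G H : LabeledMultigraph k} (h : Iso F G) (h2 : Iso G H) : Iso F H := by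
  obtain ⟨σ, hσ⟩ := h
  obtain ⟨τ, hτ⟩ := h2
  refine ⟨σ.trans τ, ?_⟩
  rw [← hτ, ← hσ, Multiset.map_map]
  refine Multiset.map_congr rfl fun e _ => ?_
  induction e using Sym2.ind with | _ a b => ?_
  rcases a with a | a <;> rcases b with b | b <;> rfl

instance setoid (k : ℕ) : Setoid (LabeledMultigraph k) :=
  ⟨Iso, ⟨Iso.refl, Iso.symm, Iso.trans⟩⟩

theorem not_isDiag_map {α β : Type*} {f : α → β} (hf : Function.Injective f) {e : Sym2 α}
    (he : ¬ e.IsDiag) : ¬ (e.map f).IsDiag := by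
  rwa [Sym2.isDiag_map hf]

/-- The product `F *ₖ G`: disjoint union, then identification of equally labeled vertices.
Edge multiplicities add up. -/
def glue (F G : LabeledMultigraph k) : LabeledMultigraph k where
  U := F.U ⊕ G.U
  edges := F.edges.map (Sym2.map (Sum.map id Sum.inl)) +
    G.edges.map (Sym2.map (Sum.map id Sum.inr))
  loopless := by
    intro e he
    rcases Multiset.mem_add.1 he with he | he <;>
      obtain ⟨f, hf, rfl⟩ := Multiset.mem_map.1 he
    · exact not_isDiag_map (Function.injective_id.sumMap Sum.inl_injective) (F.loopless f hf)
    · exact not_isDiag_map (Function.injective_id.sumMap Sum.inr_injective) (G.loopless f hf)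

/-- The graph `Eₖ` with vertices `1, …, k` and no edges. -/
def edgeless (k : ℕ) : LabeledMultigraph k where
  U := Empty
  edges := 0
  loopless := by simp

/-- Forgetting the labels. -/
def unlabel (F : LabeledMultigraph k) : LabeledMultigraph 0 where
  U := F.V
  edges := F.edges.map (Sym2.map Sum.inr)
  loopless := by
    intro e he
    obtain ⟨f, hf, rfl⟩ := Multiset.mem_map.1 he
    exact not_isDiag_map Sum.inr_injective (F.loopless f hf)

/-- The unlabeled multigraph with vertex set `U` and edge multiset `E`. -/
def ofEdges (U : Type) [Fintype U] (E : Multiset (Sym2 U)) (hE : ∀ e ∈ E, ¬ e.IsDiag) :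
    LabeledMultigraph 0 where
  U := U
  edges := E.map (Sym2.map Sum.inr)
  loopless := by
    intro e he
    obtain ⟨f, hf, rfl⟩ := Multiset.mem_map.1 he
    exact not_isDiag_map Sum.inr_injective (hE f hf)

end LabeledMultigraph

open LabeledMultigraph

/-- The set `𝒢ₖ` of isomorphism classes of `k`-labeled multigraphs. -/
def GraphClass (k : ℕ) : Type 1 := Quotient (LabeledMultigraph.setoid k)

namespace GraphClass

variable {k : ℕ}

/-- The class of a multigraph. -/
def mk (F : LabeledMultigraph k) : GraphClass k := Quotient.mk _ F

theorem glue_congr {F F2 G G2 : LabeledMultigraph k} (h : Iso F F2) (h2 : Iso G G2) :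
    Iso (glue F G) (glue F2 G2) := by
  obtain ⟨σ, hσ⟩ := h
  obtain ⟨τ, hτ⟩ := h2
  refine ⟨Equiv.sumCongr σ τ, ?_⟩
  simp only [glue, ← hσ, ← hτ, Multiset.map_add, Multiset.map_map]
  congr 1 <;> refine Multiset.map_congr rfl fun e _ => ?_ <;>
    induction e using Sym2.ind with | _ a b => ?_ <;>
    rcases a with a | a <;> rcases b with b | b <;> rfl

instance : Mul (GraphClass k) :=
  ⟨Quotient.map₂ glue fun _ _ h _ _ h2 => glue_congr h h2⟩

instance : One (GraphClass k) := ⟨mk (edgeless k)⟩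

protected theorem mul_comm (a b : GraphClass k) : a * b = b * a := by
  induction a using Quotient.inductionOn with | _ F => ?_
  induction b using Quotient.inductionOn with | _ G => ?_
  refine Quotient.sound ⟨Equiv.sumComm _ _, ?_⟩
  simp only [glue, Multiset.map_add, Multiset.map_map]
  rw [add_comm]
  congr 1 <;> refine Multiset.map_congr rfl fun e _ => ?_ <;>
    induction e using Sym2.ind with | _ a b => ?_ <;>
    rcases a with a | a <;> rcases b with b | b <;> rfl

protected theorem one_mul (a : GraphClass k) : 1 * a = a := by
  induction a using Quotient.inductionOn with | _ F => ?_
  refine Quotient.sound ⟨Equiv.emptySum Empty _, ?_⟩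
  simp only [glue, edgeless, Multiset.map_map, Multiset.map_zero, zero_add]
  conv_rhs => rw [← Multiset.map_id F.edges]
  refine Multiset.map_congr rfl fun e _ => ?_
  induction e using Sym2.ind with | _ a b => ?_
  rcases a with a | a <;> rcases b with b | b <;> rfl

protected theorem mul_assoc (a b c : GraphClass k) : a * b * c = a * (b * c) := by
  induction a using Quotient.inductionOn with | _ F => ?_
  induction b using Quotient.inductionOn with | _ G => ?_
  induction c using Quotient.inductionOn with | _ H => ?_
  refine Quotient.sound ⟨Equiv.sumAssoc _ _ _, ?_⟩
  simp only [glue, Multiset.map_add, Multiset.map_map]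
  rw [add_assoc]
  congr 1
  · refine Multiset.map_congr rfl fun e _ => ?_
    induction e using Sym2.ind with | _ a b => ?_
    rcases a with a | a <;> rcases b with b | b <;> rfl
  · congr 1 <;> refine Multiset.map_congr rfl fun e _ => ?_ <;>
      induction e using Sym2.ind with | _ a b => ?_ <;>
      rcases a with a | a <;> rcases b with b | b <;> rfl

instance : CommMonoid (GraphClass k) where
  mul_assoc := GraphClass.mul_assoc
  one_mul := GraphClass.one_mul
  mul_one a := by rw [GraphClass.mul_comm, GraphClass.one_mul]
  mul_comm := GraphClass.mul_comm

/-- The degree of a graph: the number of its unlabeled vertices. -/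
def deg : GraphClass k → ℕ :=
  Quotient.lift (fun F => Fintype.card F.U) fun _ _ ⟨σ, _⟩ => Fintype.card_congr σ

theorem deg_one : deg (1 : GraphClass k) = 0 := rfl

theorem deg_mul (a b : GraphClass k) : deg (a * b) = deg a + deg b := by
  induction a using Quotient.inductionOn with | _ F => ?_
  induction b using Quotient.inductionOn with | _ G => ?_
  exact Fintype.card_sum

/-- Forgetting the labels, on isomorphism classes. -/
def unlabel : GraphClass k → GraphClass 0 :=
  Quotient.map LabeledMultigraph.unlabel <| by
    rintro F G ⟨σ, hσ⟩
    refine ⟨Equiv.sumCongr (Equiv.refl _) σ, ?_⟩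
    simp only [LabeledMultigraph.unlabel, ← hσ, Multiset.map_map]
    refine Multiset.map_congr rfl fun e _ => ?_
    induction e using Sym2.ind with | _ a b => ?_
    rcases a with a | a <;> rcases b with b | b <;> rfl

/-- `K₁`, the unlabeled graph with one vertex.  Multiplying by it in `𝒢₀` (disjoint union)
adds an isolated vertex. -/
def singleVertex : GraphClass 0 := mk (ofEdges (Fin 1) 0 (by simp))

/-- `K₂ᵐ`, the unlabeled graph with two vertices and `m` edges between them. -/
def dipole (m : ℕ) : GraphClass 0 :=
  mk (ofEdges (Fin 2) (Multiset.replicate m s(0, 1)) (by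
    intro e he
    rw [Multiset.eq_of_mem_replicate he]
    decide))

/-- The triangle in which every edge is doubled. -/
def doubledTriangle : GraphClass 0 :=
  mk (ofEdges (Fin 3) {s(0, 1), s(0, 1), s(0, 2), s(0, 2), s(1, 2), s(1, 2)} (by decide))

/-- The path on three vertices whose edges have multiplicities `4` and `2`. -/
def pathFourTwo : GraphClass 0 :=
  mk (ofEdges (Fin 3) {s(0, 1), s(0, 1), s(0, 1), s(0, 1), s(1, 2), s(1, 2)} (by decide))

end GraphClass

/-! ## Graph algebras -/

/-- The `k`-th graph algebra `𝒜ₖ`: the monoid algebra of `𝒢ₖ` over `ℝ`.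
The elements of `𝒜₀` are the quantum multigraphs. -/
abbrev GraphAlg (k : ℕ) : Type 1 := MonoidAlgebra ℝ (GraphClass k)

/-- The degree zero part `𝒜ₖ⁰` of `𝒜ₖ`, spanned by the graphs without unlabeled vertices. -/
def flatAlg (k : ℕ) : Subalgebra ℝ (GraphAlg k) where
  carrier := {a | ∀ G ∈ a.coeff.support, GraphClass.deg G = 0}
  mul_mem' := by
    classical
    intro a b ha hb G hG
    have h := MonoidAlgebra.support_coeff_mul_subset a b hG
    obtain ⟨x, hx, y, hy, rfl⟩ := Finset.mem_mul.1 h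
    rw [GraphClass.deg_mul, ha x hx, hb y hy]
  add_mem' := by
    classical
    intro a b ha hb G hG
    rw [MonoidAlgebra.coeff_add] at hG
    rcases Finset.mem_union.1 (Finsupp.support_add hG) with h | h
    · exact ha G h
    · exact hb G h
  algebraMap_mem' := by
    classical
    intro r G hG
    rw [MonoidAlgebra.coe_algebraMap] at hG
    simp only [Function.comp_apply, MonoidAlgebra.coeff_single] at hG
    rw [Finset.mem_singleton.1 (Finsupp.support_single_subset hG)]
    rfl

/-- Unordered pairs of distinct labels. -/
abbrev LabelPair (k : ℕ) : Type := {e : Sym2 (Fin k) // ¬ e.IsDiag}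

/-- The `k`-labeled graph without unlabeled vertices that has exactly one edge, `e`. -/
def singleEdge {k : ℕ} (e : LabelPair k) : LabeledMultigraph k where
  U := Empty
  edges := {e.1.map Sum.inl}
  loopless := by
    intro f hf
    rw [Multiset.mem_singleton.1 hf]
    exact not_isDiag_map Sum.inl_injective e.2

/-- The generator `z_{ij}` of `𝒜ₖ⁰`. -/
def zFlat {k : ℕ} (e : LabelPair k) : flatAlg k :=
  ⟨MonoidAlgebra.of ℝ (GraphClass k) (GraphClass.mk (singleEdge e)), by
    classical
    intro G hG
    simp only [MonoidAlgebra.of_apply, MonoidAlgebra.coeff_single] at hG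
    rw [Finset.mem_singleton.1 (Finsupp.support_single_subset hG)]
    rfl⟩

/-- The element `z_{ij}` of `𝒜ₖ`. -/
def z {k : ℕ} (e : LabelPair k) : GraphAlg k := (zFlat e : GraphAlg k)

/-- Two elements of `𝒜₀` agree up to isolated vertices: they become equal once every graph `F`
is identified with the disjoint union of `F` and `K₁`. -/
def AgreeUpToIsolated (a b : GraphAlg 0) : Prop :=
  a - b ∈ Submodule.span ℝ (Set.range fun F : GraphClass 0 =>
    MonoidAlgebra.of ℝ (GraphClass 0) (F * GraphClass.singleVertex) -
      MonoidAlgebra.of ℝ (GraphClass 0) F)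

/-- The quantum multigraph `a` and the element `σ` of `𝒜ₖ` coincide up to labels and isolated
vertices. -/
def Coincide {k : ℕ} (a : GraphAlg 0) (σ : GraphAlg k) : Prop :=
  AgreeUpToIsolated a (MonoidAlgebra.mapDomain GraphClass.unlabel σ)

/-! ## Graph parameters -/

/-- A graph parameter: a real number for every unlabeled multigraph. -/
abbrev GraphParam : Type 1 := GraphClass 0 → ℝ

namespace GraphParam

/-- The linear extension of a graph parameter to `𝒜ₖ`, ignoring labels. -/
def ext (t : GraphParam) {k : ℕ} (a : GraphAlg k) : ℝ :=
  Finsupp.linearCombination ℝ (fun G : GraphClass k => t G.unlabel) a.coeff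

/-- The value of a graph parameter at a quantum multigraph. -/
def eval (t : GraphParam) (a : GraphAlg 0) : ℝ := Finsupp.linearCombination ℝ t a.coeff

/-- Adding an isolated vertex does not change the value. -/
def IsolateIndifferent (t : GraphParam) : Prop :=
  ∀ F : GraphClass 0, t (F * GraphClass.singleVertex) = t F

/-- `t(a²) ≥ 0` for all `a ∈ 𝒜ₖ⁰` and all `k`. -/
def FlatlyReflectionPositive (t : GraphParam) : Prop :=
  ∀ (k : ℕ) (a : GraphAlg k), a ∈ flatAlg k → 0 ≤ t.ext (a ^ 2)

/-- `|t(K₂ᵐ)| ≤ dᵐ` for all `m`. -/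
def Bounded (d : ℝ) (t : GraphParam) : Prop :=
  ∀ m : ℕ, |t (GraphClass.dipole m)| ≤ d ^ m

end GraphParam

/-! ## Preorders -/

/-- The preorder `PO(r₁, …, rₘ)` of a commutative ring: all `∑ₑ σₑ ∏ᵢ rᵢ^{eᵢ}` with `σₑ` sums of
squares; the exponent vectors `e ∈ {0,1}ᵐ` are given as the sets of indices where `e` is `1`. -/
def PO {R ι : Type*} [CommRing R] [Fintype ι] (r : ι → R) : Set R :=
  {x | ∃ σ : Finset ι → R, (∀ s, IsSumSq (σ s)) ∧ x = ∑ s : Finset ι, σ s * ∏ i ∈ s, r i}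

/-- The preorder `PO(d ± yᵢ | i)`. -/
def boxPO {R ι : Type*} [CommRing R] [Algebra ℝ R] [Fintype ι] (d : ℝ) (y : ι → R) : Set R :=
  PO (Sum.elim (fun i => algebraMap ℝ R d + y i) (fun i => algebraMap ℝ R d - y i) : ι ⊕ ι → R)

/-! ## The Robinson polynomial and the Robinson quantum multigraph -/

/-- The pair of labels `i ≠ j`. -/
abbrev pair (i j : Fin 3) (h : i ≠ j) : LabelPair 3 := ⟨s(i, j), by simpa using h⟩

/-- The Robinson polynomial in the three variables `z₁₂, z₁₃, z₂₃`. -/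
def robinsonPoly : MvPolynomial (LabelPair 3) ℝ :=
  let x := MvPolynomial.X (pair 0 1 (by decide))
  let y := MvPolynomial.X (pair 0 2 (by decide))
  let w := MvPolynomial.X (pair 1 2 (by decide))
  x ^ 6 + y ^ 6 + w ^ 6
    - (x ^ 4 * y ^ 2 + x ^ 4 * w ^ 2 + x ^ 2 * y ^ 4 + y ^ 4 * w ^ 2 + x ^ 2 * w ^ 4 + y ^ 2 * w ^ 4)
    + 3 * x ^ 2 * y ^ 2 * w ^ 2

/-- The Robinson polynomial as an element of `𝒜₃⁰`. -/
def robinsonElement : flatAlg 3 := MvPolynomial.aeval zFlat robinsonPoly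

/-- The Robinson quantum multigraph. -/
def robinsonGraph : GraphAlg 0 :=
  MonoidAlgebra.single (GraphClass.dipole 6) 1
    + MonoidAlgebra.single GraphClass.doubledTriangle 1
    - MonoidAlgebra.single GraphClass.pathFourTwo 2

/-! ## Weighted homomorphism densities into complete graphs -/

/-- Real polynomials in vertex weights `xᵢ` and edge weights `y_{ij}`, `i ≤ j ≤ n`. -/
abbrev WeightPoly (n : ℕ) : Type := MvPolynomial (Fin n ⊕ Sym2 (Fin n)) ℝ

/-- `g = x₁ + ⋯ + xₙ`. -/
def weightSum (n : ℕ) : WeightPoly n := ∑ i : Fin n, MvPolynomial.X (Sum.inl i)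

open Classical in
/-- `∑_φ ∏_v x_{φ(v)} ∏_{vw} y_{φ(v)φ(w)}` over all maps `φ` from the vertices of `F`
to `[n]`; the second product is over the edges with multiplicity. -/
def weightedCount (n : ℕ) (F : LabeledMultigraph 0) : WeightPoly n :=
  ∑ φ : F.V → Fin n, (∏ v : F.V, MvPolynomial.X (Sum.inl (φ v))) *
    (F.edges.map fun e => MvPolynomial.X (Sum.inr (e.map φ))).prod

/-- `t̃(F, n)`, in the ring `ℝ[x, y][1/g]`. -/
def weightedDensity (n : ℕ) (F : LabeledMultigraph 0) : Localization.Away (weightSum n) :=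
  algebraMap (WeightPoly n) _ (weightedCount n F) *
    IsLocalization.Away.invSelf (weightSum n) ^ Fintype.card F.V

theorem weightedDensity_congr (n : ℕ) {F G : LabeledMultigraph 0} (h : Iso F G) :
    weightedDensity n F = weightedDensity n G := by
  classical
  obtain ⟨σ, hσ⟩ := h
  let τ : F.V ≃ G.V := Equiv.sumCongr (Equiv.refl _) σ
  have hc : weightedCount n F = weightedCount n G := by
    unfold weightedCount
    refine Fintype.sum_equiv (Equiv.arrowCongr τ (Equiv.refl _)) _ _ fun φ => ?_
    have h1 : (∏ v : F.V, MvPolynomial.X (R := ℝ) (Sum.inl (β := Sym2 (Fin n)) (φ v))) =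
        ∏ v : G.V, MvPolynomial.X (Sum.inl ((Equiv.arrowCongr τ (Equiv.refl _)) φ v)) :=
      Fintype.prod_equiv τ _ _ fun v => by simp
    rw [h1, ← hσ, Multiset.map_map]
    congr 2
    refine Multiset.map_congr rfl fun e _ => ?_
    simp only [Function.comp_apply, Sym2.map_map]
    congr 3
    funext v
    have : τ v = Sum.map id σ v := by rcases v with v | v <;> rfl
    simp [← this]
  have hcard : Fintype.card F.V = Fintype.card G.V := Fintype.card_congr τ
  rw [weightedDensity, weightedDensity, hc, hcard]

/-- The linear map `t̃(·, n)` on quantum multigraphs. -/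
def tTilde (n : ℕ) (a : GraphAlg 0) : Localization.Away (weightSum n) :=
  Finsupp.linearCombination ℝ
    (Quotient.lift (weightedDensity n) fun _ _ h => weightedDensity_congr n h :
      GraphClass 0 → Localization.Away (weightSum n)) a.coeff

/-- The substitution `xᵢ = 1/3`, `y_{ii} = 0`, on polynomials. -/
def substPoly : WeightPoly 3 →ₐ[ℝ] MvPolynomial (LabelPair 3) ℝ :=
  MvPolynomial.aeval (Sum.elim (fun _ => MvPolynomial.C (1 / 3))
    (fun e => if h : e.IsDiag then 0 else MvPolynomial.X ⟨e, h⟩))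

theorem substPoly_weightSum : substPoly (weightSum 3) = 1 := by
  simp only [substPoly, weightSum, Fin.sum_univ_three, map_add, MvPolynomial.aeval_X,
    Sum.elim_inl]
  rw [← MvPolynomial.C_add, ← MvPolynomial.C_add, ← MvPolynomial.C_1]
  norm_num

/-- The substitution `xᵢ = 1/3`, `y_{ii} = 0`, on `ℝ[x, y][1/g]`. -/
def subst : Localization.Away (weightSum 3) →+* MvPolynomial (LabelPair 3) ℝ :=
  IsLocalization.Away.lift (g := substPoly.toRingHom) (weightSum 3)
    (by
      have h : substPoly.toRingHom (weightSum 3) = 1 := substPoly_weightSum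
      rw [h]
      exact isUnit_one)

/-! ## Simple graphs and simple quantum graphs -/

/-- A finite simple graph. -/
structure FinSimpleGraph where
  V : Type
  [fintypeV : Fintype V]
  graph : SimpleGraph V

attribute [instance] FinSimpleGraph.fintypeV

namespace FinSimpleGraph

instance setoid : Setoid FinSimpleGraph where
  r F G := Nonempty (F.graph ≃g G.graph)
  iseqv := ⟨fun _ => ⟨SimpleGraph.Iso.refl⟩, fun ⟨f⟩ => ⟨f.symm⟩, fun ⟨f⟩ ⟨g⟩ => ⟨f.trans g⟩⟩

/-- The homomorphism density `t(F, G) = hom(F, G) / |V_G| ^ |V_F|`. -/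
def density (F : FinSimpleGraph) {W : Type} [Fintype W] (G : SimpleGraph W) : ℝ :=
  (Nat.card (F.graph →g G) : ℝ) / (Fintype.card W : ℝ) ^ Fintype.card F.V

theorem density_congr {F F2 : FinSimpleGraph} (h : F ≈ F2) {W : Type} [Fintype W]
    (G : SimpleGraph W) : F.density G = F2.density G := by
  obtain ⟨f⟩ := h
  have h1 : Nat.card (F.graph →g G) = Nat.card (F2.graph →g G) :=
    Nat.card_congr ⟨fun φ => φ.comp f.symm.toHom, fun φ => φ.comp f.toHom,
      fun φ => by ext; simp, fun φ => by ext; simp⟩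
  have h2 : Fintype.card F.V = Fintype.card F2.V := Fintype.card_congr f.toEquiv
  rw [density, density, h1, h2]

end FinSimpleGraph

/-- Isomorphism classes of finite simple graphs. -/
def SimpleClass : Type 1 := Quotient FinSimpleGraph.setoid

/-- The class of a simple graph. -/
def SimpleClass.mk {V : Type} [Fintype V] (G : SimpleGraph V) : SimpleClass :=
  Quotient.mk _ ⟨V, G⟩

/-- A simple quantum graph: a formal real linear combination of finite simple graphs. -/
abbrev SimpleQuantumGraph : Type 1 := SimpleClass →₀ ℝ

namespace SimpleQuantumGraph

/-- `t(a, G)`. -/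
def density (a : SimpleQuantumGraph) {W : Type} [Fintype W] (G : SimpleGraph W) : ℝ :=
  Finsupp.linearCombination ℝ
    (Quotient.lift (fun F : FinSimpleGraph => F.density G)
      fun _ _ h => FinSimpleGraph.density_congr h G : SimpleClass → ℝ) a

/-- `t(a, G) ≥ 0` for all finite simple graphs `G`. -/
def Nonneg (a : SimpleQuantumGraph) : Prop :=
  ∀ (W : Type) [Fintype W] [Nonempty W] (G : SimpleGraph W), 0 ≤ a.density G

/-- The triangle minus twice the path on three vertices plus a single edge. -/
def trianglePathEdge : SimpleQuantumGraph :=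
  Finsupp.single (SimpleClass.mk (⊤ : SimpleGraph (Fin 3))) 1
    - Finsupp.single
        (SimpleClass.mk (SimpleGraph.fromEdgeSet {s(0, 1), s(1, 2)} : SimpleGraph (Fin 3))) 2
    + Finsupp.single (SimpleClass.mk (⊤ : SimpleGraph (Fin 2))) 1

/-- The triangle minus twice the disjoint union of two edges plus a single edge. -/
def goodman : SimpleQuantumGraph :=
  Finsupp.single (SimpleClass.mk (⊤ : SimpleGraph (Fin 3))) 1
    - Finsupp.single
        (SimpleClass.mk (SimpleGraph.fromEdgeSet {s(0, 1), s(2, 3)} : SimpleGraph (Fin 4))) 2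
    + Finsupp.single (SimpleClass.mk (⊤ : SimpleGraph (Fin 2))) 1

end SimpleQuantumGraph

/-- Reducing the edge multiplicities of an unlabeled multigraph to one. -/
def reduceGraph (F : LabeledMultigraph 0) : SimpleClass :=
  SimpleClass.mk (SimpleGraph.fromEdgeSet {e : Sym2 F.V | e ∈ F.edges})

theorem reduceGraph_congr {F G : LabeledMultigraph 0} (h : Iso F G) :
    reduceGraph F = reduceGraph G := by
  obtain ⟨σ, hσ⟩ := h
  let τ : F.V ≃ G.V := Equiv.sumCongr (Equiv.refl _) σ
  have hτ : ∀ v, τ v = Sum.map id σ v := by rintro (v | v) <;> rfl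
  refine Quotient.sound ⟨⟨τ, ?_⟩⟩
  intro v w
  have hinj : Function.Injective (Sym2.map (Sum.map (id : Fin 0 → Fin 0) σ)) :=
    Sym2.map.injective (Function.injective_id.sumMap σ.injective)
  simp only [SimpleGraph.fromEdgeSet_adj, Set.mem_ofPred_eq, ne_eq, τ.injective.eq_iff]
  rw [← hσ, hτ, hτ, ← Sym2.map_mk, Multiset.mem_map_of_injective hinj]

/-- Reducing all edge multiplicities of a quantum multigraph to one. -/
def reduce (a : GraphAlg 0) : SimpleQuantumGraph :=
  Finsupp.mapDomain (Quotient.lift reduceGraph fun _ _ h => reduceGraph_congr h) a.coeff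

end QMG

end

open QMG

noncomputable section

namespace QMG

/-! ## Preorders are subsemirings -/

section Preorder

variable {R ι : Type*} [CommRing R] [Fintype ι]

/-! Membership of `R + ε`: with `θ = x² + y²`, the product `θ R` is a sum of three squares, and `R ≥
-3d⁴θ` modulo the preorder of the box. Put `u = 1 - θ/(2d²)`, so that `u` and `1 - u` lie in the
preorder, and split `R = (1 - u^N) R + u^N R`. Since `1 - u^N` is a multiple of `θ` by an element of
the preorder, the first part is a member; the second loses at most a multiple of `(1 - u) u^N ≤ 1/(N
+ 1)`, which `ε` absorbs (`robinson_add_mem`).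

Positivity on parameters: Cauchy–Schwarz, iterated along powers of two, turns the moment bound into
`|L(p²z)| ≤ d L(p²)`. Multiplying the argument of `L` by `d ± z` therefore gives a functional of the
same kind, and `L` is nonnegative on the whole preorder (`BoxFunctional.nonneg_of_mem_boxPO`). Apply
this to `R + ε` and let `ε` tend to zero.

Obstruction: the generators `d ± z` are positive at the origin, so members of the preorder are sums
of `p² u` with `u(0) > 0`. Lowest-order terms of such a sum cannot cancel, so `R`, a form of degree
6, would be a positive combination of squares of cubic forms. Each cubic vanishes at the eight zeros
`(±1, ±1, 1)`, `(±1, 0, 1)`, `(0, ±1, 1)` of `R`, hence also at `(0, 0, 1)`, where `R = 1`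
(`robinsonPoly_notMem_localCone`).

This transfers to graph algebras through densities in a complete graph on three equally weighted
vertices. For each placement of the labels the density is an algebra homomorphism, forgetting labels
averages over placements, isolated vertices count 1, and the Robinson quantum multigraph goes to
`(2/27) R` (`not_coincide_of_mem_boxPO`).

The simple-graph inequalities come from a pointwise inequality on triples of vertices, followed by
Cauchy–Schwarz for degrees. -/

theorem PO.zero_mem (r : ι → R) : (0 : R) ∈ PO r :=
  ⟨fun _ => 0, fun _ => IsSumSq.zero, by simp⟩

theorem PO.add_mem {r : ι → R} {x y : R} (hx : x ∈ PO r) (hy : y ∈ PO r) : x + y ∈ PO r := by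
  obtain ⟨σ, hσ, rfl⟩ := hx
  obtain ⟨τ, hτ, rfl⟩ := hy
  refine ⟨fun s => σ s + τ s, fun s => (hσ s).add (hτ s), ?_⟩
  simp only [add_mul, Finset.sum_add_distrib]

theorem PO.sum_mem {r : ι → R} {κ : Type*} (s : Finset κ) {f : κ → R} (h : ∀ i ∈ s, f i ∈ PO r) :
    ∑ i ∈ s, f i ∈ PO r :=
  Finset.sum_induction f (· ∈ PO r) (fun _ _ => PO.add_mem) (PO.zero_mem r) h

theorem PO.sumSq_mul_prod_mem (r : ι → R) {σ : R} (hσ : IsSumSq σ) (s : Finset ι) :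
    σ * ∏ i ∈ s, r i ∈ PO r := by
  classical
  refine ⟨fun t => if t = s then σ else 0, fun t => ?_, ?_⟩
  · dsimp only
    split_ifs
    exacts [hσ, IsSumSq.zero]
  · simp [ite_mul]

theorem PO.sumSq_mem (r : ι → R) {σ : R} (hσ : IsSumSq σ) : σ ∈ PO r := by
  simpa using PO.sumSq_mul_prod_mem r hσ ∅

/-- Exponents reduce modulo 2: the generators common to both index sets occur squared and join the
sum-of-squares coefficient, leaving the product over the symmetric difference. -/
theorem PO.mul_mem {r : ι → R} {x y : R} (hx : x ∈ PO r) (hy : y ∈ PO r) : x * y ∈ PO r := by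
  classical
  obtain ⟨σ, hσ, rfl⟩ := hx
  obtain ⟨τ, hτ, rfl⟩ := hy
  rw [Finset.sum_mul_sum]
  refine PO.sum_mem _ fun s _ => PO.sum_mem _ fun t _ => ?_
  have h : (σ s * ∏ i ∈ s, r i) * (τ t * ∏ i ∈ t, r i) =
      (σ s * τ t * ((∏ i ∈ s ∩ t, r i) * ∏ i ∈ s ∩ t, r i)) * ∏ i ∈ symmDiff s t, r i := by
    have h1 : (∏ i ∈ s, r i) = (∏ i ∈ s ∩ t, r i) * ∏ i ∈ s \ t, r i :=
      (Finset.prod_inter_mul_prod_sdiff s t r).symm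
    have h2 : (∏ i ∈ t, r i) = (∏ i ∈ s ∩ t, r i) * ∏ i ∈ t \ s, r i := by
      rw [Finset.inter_comm, Finset.prod_inter_mul_prod_sdiff]
    have h3 : ∏ i ∈ symmDiff s t, r i = (∏ i ∈ s \ t, r i) * ∏ i ∈ t \ s, r i := by
      rw [symmDiff_def]
      exact Finset.prod_union disjoint_sdiff_sdiff
    rw [h1, h2, h3]
    ring
  rw [h]
  exact PO.sumSq_mul_prod_mem r (((hσ s).mul (hτ t)).mul (IsSumSq.mul_self _)) _

/-- The preorder generated by `r`, as a subsemiring. -/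
def preorder (r : ι → R) : Subsemiring R where
  carrier := PO r
  zero_mem' := PO.zero_mem r
  one_mem' := PO.sumSq_mem r IsSumSq.one
  add_mem' := PO.add_mem
  mul_mem' := PO.mul_mem

theorem mul_self_mem_preorder (r : ι → R) (x : R) : x * x ∈ preorder r :=
  PO.sumSq_mem r (IsSumSq.mul_self x)

theorem generator_mem_preorder (r : ι → R) (i : ι) : r i ∈ preorder r := by
  change r i ∈ PO r
  simpa using PO.sumSq_mul_prod_mem r IsSumSq.one {i}

end Preorder

/-! ## The Robinson polynomial plus a positive constant -/

/-- The value of the Robinson polynomial. -/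
def robinson {R : Type*} [CommRing R] (x y w : R) : R :=
  x ^ 6 + y ^ 6 + w ^ 6
    - (x ^ 4 * y ^ 2 + x ^ 4 * w ^ 2 + x ^ 2 * y ^ 4 + y ^ 4 * w ^ 2 + x ^ 2 * w ^ 4 + y ^ 2 * w ^ 4)
    + 3 * x ^ 2 * y ^ 2 * w ^ 2

theorem map_robinson {R S : Type*} [CommRing R] [CommRing S] (f : R →+* S) (x y w : R) :
    f (robinson x y w) = robinson (f x) (f y) (f w) := by
  simp only [robinson, map_add, map_sub, map_mul, map_pow, map_ofNat]

section Cone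

variable {A : Type*} [CommRing A] (S : Subsemiring A)

theorem one_sub_pow_mem {u : A} (hu : u ∈ S) (hu1 : 1 - u ∈ S) (n : ℕ) : 1 - u ^ n ∈ S := by
  rw [← mul_neg_geom_sum]
  exact mul_mem hu1 (sum_mem fun i _ => pow_mem hu i)

/-- A certificate of `(1 - u) u^n ≤ 1/(n + 1)` on `[0, 1]`: in `1 = u^(n+1) + (1 - u) ∑ u^k`, each
of the `n + 1` summands `u^k` dominates `u^n`. -/
theorem one_sub_mul_pow_mem {u : A} (hu : u ∈ S) (hu1 : 1 - u ∈ S) (n : ℕ) :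
    1 - (n + 1) * ((1 - u) * u ^ n) ∈ S := by
  have h : 1 - (n + 1) * ((1 - u) * u ^ n) =
      u ^ (n + 1) + (1 - u) * ∑ k ∈ Finset.range (n + 1), (u ^ k - u ^ n) := by
    rw [Finset.sum_sub_distrib, mul_sub, mul_neg_geom_sum]
    simp
    ring
  rw [h]
  refine add_mem (pow_mem hu _) (mul_mem hu1 (sum_mem fun k hk => ?_))
  have hk' : k + (n - k) = n := by have := Finset.mem_range.1 hk; omega
  have h2 : u ^ k - u ^ n = u ^ k * (1 - u ^ (n - k)) := by
    rw [mul_sub, ← pow_add, hk', mul_one]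
  rw [h2]
  exact mul_mem (pow_mem hu k) (one_sub_pow_mem S hu hu1 _)

variable [Algebra ℝ A]

theorem algebraMap_mem_of_mul_self_mem (hS : ∀ x : A, x * x ∈ S) {r : ℝ} (hr : 0 ≤ r) :
    algebraMap ℝ A r ∈ S := by
  rw [← Real.mul_self_sqrt hr, map_mul]
  exact hS _

/-- On a box, the Robinson polynomial plus any positive constant lies in every preorder that
contains the inequalities of the box. -/
theorem robinson_add_mem (hS : ∀ x : A, x * x ∈ S) {d : ℝ} (hd : 0 < d) {x y w : A}
    (hx : algebraMap ℝ A d + x ∈ S) (hx' : algebraMap ℝ A d - x ∈ S)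
    (hy : algebraMap ℝ A d + y ∈ S) (hy' : algebraMap ℝ A d - y ∈ S)
    (hw : algebraMap ℝ A d + w ∈ S) (hw' : algebraMap ℝ A d - w ∈ S) {ε : ℝ} (hε : 0 < ε) :
    robinson x y w + algebraMap ℝ A ε ∈ S := by
  have hsq : ∀ x : A, x ^ 2 ∈ S := fun x => by rw [sq]; exact hS x
  have hmap : ∀ {r : ℝ}, 0 ≤ r → algebraMap ℝ A r ∈ S :=
    fun hr => algebraMap_mem_of_mul_self_mem S hS hr
  set δ := algebraMap ℝ A d with hδ
  have box : ∀ {v : A}, δ + v ∈ S → δ - v ∈ S → δ ^ 2 - v ^ 2 ∈ S := fun {v} h h' => by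
    rw [sq_sub_sq]; exact mul_mem h h'
  have ha := box hx hx'
  have hb := box hy hy'
  have hc := box hw hw'
  set θ := x ^ 2 + y ^ 2 with hθ
  have hθS : θ ∈ S := add_mem (hsq x) (hsq y)
  have hθS' : 2 * δ ^ 2 - θ ∈ S := by
    have := add_mem ha hb
    convert this using 1
    rw [hθ]; ring
  -- the normalized variable
  set D := 2 * d ^ 2 with hD
  have hDpos : 0 < D := by positivity
  set I := algebraMap ℝ A D⁻¹ with hI
  have hIS : I ∈ S := hmap (by positivity)
  have hDI : 2 * δ ^ 2 * I = 1 := by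
    have : algebraMap ℝ A (D * D⁻¹) = 1 := by rw [mul_inv_cancel₀ hDpos.ne', map_one]
    rw [← this, map_mul, hD, map_mul, map_pow, map_ofNat]
  set u := 1 - θ * I with hu
  have huS : u ∈ S := by
    have : u = (2 * δ ^ 2 - θ) * I := by rw [sub_mul, hDI]
    rw [this]; exact mul_mem hθS' hIS
  have hu1 : 1 - u = θ * I := by rw [hu]; ring
  have huS1 : 1 - u ∈ S := by rw [hu1]; exact mul_mem hθS hIS
  have hθu : θ = 2 * δ ^ 2 * (1 - u) := by rw [hu1]; linear_combination (-θ) * hDI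
  -- the coefficient of the error term
  set K := 3 * d ^ 4 * D with hK
  obtain ⟨N, hN⟩ := exists_nat_gt (K / ε)
  have hN1 : (0 : ℝ) < N + 1 := by positivity
  have hKN : K / (N + 1) ≤ ε := by
    rw [div_le_iff₀ hN1]
    rw [div_lt_iff₀ hε] at hN
    nlinarith
  -- Since `θ = D (1 - u)`, the error equals `K (1 - u) u^N`, at most `K / (N + 1) ≤ ε`.
  have herr : algebraMap ℝ A ε - 3 * δ ^ 4 * (θ * u ^ N) ∈ S := by
    have h1 : algebraMap ℝ A (ε - K / (N + 1)) +
        algebraMap ℝ A (K / (N + 1)) * (1 - (N + 1) * ((1 - u) * u ^ N)) =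
        algebraMap ℝ A ε - 3 * δ ^ 4 * (θ * u ^ N) := by
      have h2 : algebraMap ℝ A (K / (N + 1)) * (N + 1) = 3 * δ ^ 4 * (2 * δ ^ 2) := by
        have : algebraMap ℝ A ((K / (N + 1)) * (N + 1)) = algebraMap ℝ A K := by
          rw [div_mul_cancel₀ _ hN1.ne']
        simp only [hK, hD, map_mul, map_add, map_natCast, map_one, map_pow, map_ofNat] at this ⊢
        exact this
      rw [map_sub]
      linear_combination (-(1 - u) * u ^ N) * h2 + 3 * δ ^ 4 * u ^ N * hθu
    rw [← h1]
    exact add_mem (hmap (by linarith)) (mul_mem (hmap (by positivity))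
      (one_sub_mul_pow_mem S huS huS1 N))
  -- the remaining pieces
  have hgeom : θ * I * ∑ i ∈ Finset.range N, u ^ i = 1 - u ^ N := by
    rw [← hu1, mul_neg_geom_sum]
  -- The constant 3 arises from `w⁴ ≤ d⁴` and `w²θ ≤ 2d⁴`.
  have hq : (x ^ 2 - y ^ 2) ^ 2 - w ^ 4 - w ^ 2 * θ + 3 * δ ^ 4 ∈ S := by
    have : (x ^ 2 - y ^ 2) ^ 2 - w ^ 4 - w ^ 2 * θ + 3 * δ ^ 4 =
        (x ^ 2 - y ^ 2) ^ 2 + (δ ^ 2 - w ^ 2) * (δ ^ 2 + w ^ 2) +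
          (δ ^ 2 * (2 * δ ^ 2 - θ) + θ * (δ ^ 2 - w ^ 2)) := by ring
    rw [this]
    exact add_mem (add_mem (hsq _) (mul_mem hc (add_mem (hsq _) (hsq _))))
      (add_mem (mul_mem (hsq _) hθS') (mul_mem hθS hc))
  have hmul : θ * robinson x y w = ((x ^ 2 - y ^ 2) * (x ^ 2 + y ^ 2 - w ^ 2)) ^ 2 +
      (y * w * (y ^ 2 - w ^ 2)) ^ 2 + (x * w * (x ^ 2 - w ^ 2)) ^ 2 := by
    rw [hθ, robinson]; ring
  have hsplit : robinson x y w = (w ^ 3) ^ 2 + 5 * (x * y * w) ^ 2 +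
      θ * ((x ^ 2 - y ^ 2) ^ 2 - w ^ 4 - w ^ 2 * θ) := by
    rw [hθ, robinson]; ring
  -- The weights `1 - u^N` and `u^N` combine the two representations `hmul` and `hsplit`; the term
  -- `3δ⁴θu^N` is added and subtracted.
  have hfin : robinson x y w + algebraMap ℝ A ε =
      I * (∑ i ∈ Finset.range N, u ^ i) * (θ * robinson x y w) +
      u ^ N * ((w ^ 3) ^ 2 + 5 * (x * y * w) ^ 2) +
      u ^ N * (θ * ((x ^ 2 - y ^ 2) ^ 2 - w ^ 4 - w ^ 2 * θ + 3 * δ ^ 4)) +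
      (algebraMap ℝ A ε - 3 * δ ^ 4 * (θ * u ^ N)) := by
    linear_combination (-robinson x y w) * hgeom + u ^ N * hsplit
  have h5 : (5 : A) ∈ S := by exact_mod_cast natCast_mem S 5
  rw [hfin, hmul]
  exact add_mem (add_mem (add_mem
    (mul_mem (mul_mem hIS (sum_mem fun i _ => pow_mem huS i))
      (add_mem (add_mem (hsq _) (hsq _)) (hsq _)))
    (mul_mem (pow_mem huS N) (add_mem (hsq _) (mul_mem h5 (hsq _)))))
    (mul_mem (pow_mem huS N) (mul_mem hθS hq))) herr

end Cone

/-- The multiplier `x² + y²` makes the polynomial a sum of squares; where the multiplier vanishes,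
only `w⁶` remains. -/
theorem robinson_nonneg (x y w : ℝ) : 0 ≤ robinson x y w := by
  have hmul : (x ^ 2 + y ^ 2) * robinson x y w =
      ((x ^ 2 - y ^ 2) * (x ^ 2 + y ^ 2 - w ^ 2)) ^ 2 +
      (y * w * (y ^ 2 - w ^ 2)) ^ 2 + (x * w * (x ^ 2 - w ^ 2)) ^ 2 := by
    rw [robinson]; ring
  rcases (by positivity : 0 ≤ x ^ 2 + y ^ 2).eq_or_lt with h | h
  · have hx : x = 0 := by nlinarith [sq_nonneg x, sq_nonneg y]
    have hy : y = 0 := by nlinarith [sq_nonneg x, sq_nonneg y]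
    subst hx hy
    have h0 : robinson 0 0 w = (w ^ 3) ^ 2 := by rw [robinson]; ring
    rw [h0]
    positivity
  · refine nonneg_of_mul_nonneg_right ?_ h
    rw [hmul]
    positivity

theorem aeval_robinsonPoly {A : Type*} [CommRing A] [Algebra ℝ A] (v : LabelPair 3 → A) :
    MvPolynomial.aeval v robinsonPoly =
      robinson (v (pair 0 1 (by decide))) (v (pair 0 2 (by decide))) (v (pair 1 2 (by decide))) := by
  simp [robinsonPoly, robinson]

theorem eval_robinsonPoly_nonneg (v : LabelPair 3 → ℝ) :
    0 ≤ MvPolynomial.eval v robinsonPoly := by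
  rw [← MvPolynomial.coe_aeval_eq_eval, RingHom.coe_coe, aeval_robinsonPoly]
  exact robinson_nonneg _ _ _

theorem robinsonElement_add_mem {d : ℝ} (hd : 0 < d) {ε : ℝ} (hε : 0 < ε) :
    robinsonElement + algebraMap ℝ (flatAlg 3) ε ∈ boxPO d (zFlat (k := 3)) := by
  rw [robinsonElement, aeval_robinsonPoly]
  have hp := generator_mem_preorder (R := flatAlg 3)
    (Sum.elim (fun i => algebraMap ℝ _ d + zFlat i) (fun i => algebraMap ℝ _ d - zFlat i) :
      LabelPair 3 ⊕ LabelPair 3 → flatAlg 3)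
  exact robinson_add_mem (preorder _) (mul_self_mem_preorder _) hd (hp (.inl _)) (hp (.inr _))
    (hp (.inl _)) (hp (.inr _)) (hp (.inl _)) (hp (.inr _)) hε

/-! ## The Robinson polynomial is not a sum of squares, even locally at the origin -/

section Univariate

open Polynomial

/-- The lowest order coefficient of `F` is nonnegative. -/
def LowestNonneg (F : ℝ[X]) : Prop := ∀ m : ℕ, X ^ m ∣ F → 0 ≤ F.coeff m

/-- Two nonnegative lowest coefficients cannot cancel, so the order of a sum is the smaller of the
two orders. -/
theorem LowestNonneg.dvd {F G : ℝ[X]} (hF : LowestNonneg F) (hG : LowestNonneg G) {m : ℕ}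
    (h : X ^ m ∣ F + G) : X ^ m ∣ F ∧ X ^ m ∣ G := by
  induction m with
  | zero => simp
  | succ m ih =>
    obtain ⟨h1, h2⟩ := ih ((pow_dvd_pow X m.le_succ).trans h)
    have h3 : F.coeff m + G.coeff m = 0 := by
      simpa using X_pow_dvd_iff.1 h m m.lt_succ_self
    have h4 := hF m h1
    have h5 := hG m h2
    refine ⟨X_pow_dvd_iff.2 fun d hd => ?_, X_pow_dvd_iff.2 fun d hd => ?_⟩ <;>
      rcases (Nat.lt_succ_iff.1 hd).eq_or_lt with rfl | hd'
    · linarith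
    · exact X_pow_dvd_iff.1 h1 d hd'
    · linarith
    · exact X_pow_dvd_iff.1 h2 d hd'

theorem LowestNonneg.add {F G : ℝ[X]} (hF : LowestNonneg F) (hG : LowestNonneg G) :
    LowestNonneg (F + G) := fun m h => by
  obtain ⟨h1, h2⟩ := hF.dvd hG h
  rw [coeff_add]
  exact add_nonneg (hF m h1) (hG m h2)

/-- As `U` does not vanish at 0, the order of `P² U` at 0 is exactly twice that of `P`. -/
theorem exists_eq_X_pow_mul_of_dvd_sq_mul {P U : ℝ[X]} (hU : U.coeff 0 ≠ 0) {m : ℕ}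
    (h : X ^ m ∣ P ^ 2 * U) : ∃ (r : ℕ) (Q : ℝ[X]), P = X ^ r * Q ∧ m ≤ 2 * r := by
  rcases eq_or_ne P 0 with rfl | hP
  -- The zero polynomial has every order; `m` is large enough.
  · exact ⟨m, 0, by simp, by omega⟩
  obtain ⟨Q, hQ, hQ0⟩ := exists_eq_pow_rootMultiplicity_mul_and_not_dvd P hP 0
  rw [C_0, sub_zero] at hQ hQ0
  refine ⟨_, Q, hQ, ?_⟩
  by_contra! hlt
  have h1 := X_pow_dvd_iff.1 h _ hlt
  rw [X_dvd_iff] at hQ0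
  have h2 : P ^ 2 * U = X ^ (2 * rootMultiplicity 0 P) * (Q ^ 2 * U) := by
    nth_rewrite 1 [hQ]
    ring
  rw [h2, coeff_X_pow_mul', if_pos le_rfl, Nat.sub_self, mul_coeff_zero, sq, mul_coeff_zero] at h1
  exact mul_ne_zero (mul_ne_zero hQ0 hQ0) hU h1

theorem lowestNonneg_sq_mul (P : ℝ[X]) {U : ℝ[X]} (hU : 0 < U.coeff 0) :
    LowestNonneg (P ^ 2 * U) := fun m h => by
  obtain ⟨r, Q, rfl, hr⟩ := exists_eq_X_pow_mul_of_dvd_sq_mul hU.ne' h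
  have h2 : (X ^ r * Q) ^ 2 * U = X ^ (2 * r) * (Q ^ 2 * U) := by ring
  rw [h2, coeff_X_pow_mul']
  split_ifs with h3
  · rw [show m - 2 * r = 0 by omega, mul_coeff_zero, sq, mul_coeff_zero]
    exact mul_nonneg (mul_self_nonneg _) hU.le
  · exact le_rfl

theorem coeff_sq_mul_of_dvd {P U : ℝ[X]} (hU : U.coeff 0 ≠ 0) {m : ℕ}
    (h : X ^ (2 * m) ∣ P ^ 2 * U) : (P ^ 2 * U).coeff (2 * m) = P.coeff m ^ 2 * U.coeff 0 := by
  obtain ⟨r, Q, rfl, hr⟩ := exists_eq_X_pow_mul_of_dvd_sq_mul hU h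
  have h2 : (X ^ r * Q) ^ 2 * U = X ^ (2 * r) * (Q ^ 2 * U) := by ring
  rw [h2, coeff_X_pow_mul', coeff_X_pow_mul']
  by_cases hrm : r ≤ m
  · obtain rfl : r = m := by omega
    simp [mul_coeff_zero, sq]
  · rw [if_neg (by omega), if_neg hrm]
    simp

end Univariate

/-! ### Restriction to lines and the local cone at the origin. -/

section Multivariate

open MvPolynomial

/-- Restriction of a polynomial to the line through `0` and `v`. -/
def restrictLine {σ : Type*} (v : σ → ℝ) : MvPolynomial σ ℝ →ₐ[ℝ] Polynomial ℝ :=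
  aeval fun i => Polynomial.C (v i) * Polynomial.X

theorem coeff_zero_restrictLine {σ : Type*} (v : σ → ℝ) (u : MvPolynomial σ ℝ) :
    (restrictLine v u).coeff 0 = constantCoeff u := by
  have h : Polynomial.constantCoeff.comp (restrictLine v).toRingHom = constantCoeff := by
    apply MvPolynomial.ringHom_ext <;> intros <;> simp [restrictLine]
  exact congrArg (fun f => f u) h

/-- Degree along a line through the origin is total degree, so the coefficient of `X^m` is the
degree-`m` form evaluated at `v`. This replaces homogeneous components in what follows. -/
theorem coeff_restrictLine_monomial {σ : Type*} [Fintype σ] (v : σ → ℝ) (s : σ →₀ ℕ) (c : ℝ)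
    (m : ℕ) : (restrictLine v (monomial s c)).coeff m =
      if m = ∑ i, s i then c * ∏ i, v i ^ s i else 0 := by
  have h : restrictLine v (monomial s c) =
      Polynomial.C (c * ∏ i, v i ^ s i) * Polynomial.X ^ (∑ i, s i) := by
    rw [restrictLine, aeval_monomial, Finsupp.prod_fintype _ _ (by simp)]
    simp only [mul_pow, Finset.prod_mul_distrib, Finset.prod_pow_eq_pow_sum, map_mul, map_prod,
      map_pow]
    rw [← mul_assoc]
    rfl
  rw [h, Polynomial.coeff_C_mul_X_pow]

theorem univ_labelPair_three : (Finset.univ : Finset (LabelPair 3)) =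
    {pair 0 1 (by decide), pair 0 2 (by decide), pair 1 2 (by decide)} := by decide

/-- The point `(a, b, 1)`. -/
def affinePoint (a b : ℝ) (e : LabelPair 3) : ℝ :=
  if e = pair 0 1 (by decide) then a else if e = pair 0 2 (by decide) then b else 1

theorem coeff_affinePoint_monomial (a b : ℝ) (s : LabelPair 3 →₀ ℕ) (c : ℝ) :
    (restrictLine (affinePoint a b) (monomial s c)).coeff 3 =
      if 3 = s (pair 0 1 (by decide)) + (s (pair 0 2 (by decide)) + s (pair 1 2 (by decide))) then
        c * (a ^ s (pair 0 1 (by decide)) * b ^ s (pair 0 2 (by decide))) else 0 := by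
  have h1 : pair 0 2 (by decide) ≠ pair 0 1 (by decide) := by decide
  have h2 : pair 1 2 (by decide) ≠ pair 0 1 (by decide) := by decide
  have h3 : pair 1 2 (by decide) ≠ pair 0 2 (by decide) := by decide
  rw [coeff_restrictLine_monomial, univ_labelPair_three]
  have hn1 : pair 0 1 (by decide) ∉
      ({pair 0 2 (by decide), pair 1 2 (by decide)} : Finset (LabelPair 3)) := by decide
  have hn2 : pair 0 2 (by decide) ∉ ({pair 1 2 (by decide)} : Finset (LabelPair 3)) := by decide
  rw [Finset.sum_insert hn1, Finset.sum_insert hn2, Finset.sum_singleton, Finset.prod_insert hn1,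
    Finset.prod_insert hn2, Finset.prod_singleton]
  simp [affinePoint, h1, h2, h3]

/-- The mixed second difference of a cubic form vanishes. -/
theorem second_difference_eq_zero (p : MvPolynomial (LabelPair 3) ℝ) :
    let q : ℝ → ℝ → ℝ := fun a b => (restrictLine (affinePoint a b) p).coeff 3
    q 1 1 + q 1 (-1) + q (-1) 1 + q (-1) (-1) + 4 * q 0 0 =
      2 * (q 1 0 + q (-1) 0 + q 0 1 + q 0 (-1)) := by
  induction p using MvPolynomial.induction_on' with
  | monomial s c =>
    simp only [coeff_affinePoint_monomial]
    generalize s (pair 0 1 (by decide)) = i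
    generalize s (pair 0 2 (by decide)) = j
    generalize s (pair 1 2 (by decide)) = k
    -- The functional is a product of second differences in `a` and `b`; it kills `a^i b^j` unless
    -- `i` and `j` are both even and positive, which needs degree at least 4.
    by_cases h : 3 = i + (j + k)
    · simp only [if_pos h]
      have hi : i ≤ 3 := by omega
      have hj : j ≤ 3 := by omega
      interval_cases i <;> interval_cases j <;> first | omega | (norm_num; try ring)
    · simp only [if_neg h]; norm_num
  | add p q hp hq =>
    simp only [map_add, Polynomial.coeff_add] at hp hq ⊢
    linarith

theorem restrictLine_robinsonPoly (a b : ℝ) :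
    restrictLine (affinePoint a b) robinsonPoly =
      Polynomial.X ^ 6 * Polynomial.C (robinson a b 1) := by
  have h1 : pair 0 2 (by decide) ≠ pair 0 1 (by decide) := by decide
  have h2 : pair 1 2 (by decide) ≠ pair 0 1 (by decide) := by decide
  have h3 : pair 1 2 (by decide) ≠ pair 0 2 (by decide) := by decide
  rw [restrictLine, aeval_robinsonPoly]
  simp only [affinePoint, if_neg h1, if_neg h2, if_neg h3, if_true, robinson, map_add, map_sub,
    map_mul, map_pow, map_ofNat, map_one]
  ring

/-- The cone of sums of polynomials `p² u`, where `u` is positive at the origin. -/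
def localCone (σ : Type*) : AddSubmonoid (MvPolynomial σ ℝ) :=
  AddSubmonoid.closure {f | ∃ p u, 0 < constantCoeff u ∧ f = p ^ 2 * u}

theorem lowestNonneg_of_mem_localCone {σ : Type*} (v : σ → ℝ) {f : MvPolynomial σ ℝ}
    (hf : f ∈ localCone σ) : LowestNonneg (restrictLine v f) := by
  refine AddSubmonoid.closure_induction ?_ ?_ (fun f g _ _ hf hg => ?_) hf
  · rintro _ ⟨p, u, hu, rfl⟩
    rw [map_mul, map_pow]
    exact lowestNonneg_sq_mul _ (by rwa [coeff_zero_restrictLine])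
  · intro m _
    simp
  · rw [map_add]
    exact hf.add hg

/-- Every summand `p² u` is shown to have degree-6 part zero at `(0, 0, 1)`, although the parts add
up to the value 1 of the Robinson polynomial there. -/
theorem robinsonPoly_notMem_localCone : robinsonPoly ∉ localCone (LabelPair 3) := by
  intro h
  obtain ⟨l, hl, hsum⟩ := AddSubmonoid.exists_multiset_of_mem_closure h
  have key : ∀ f ∈ l, (restrictLine (affinePoint 0 0) f).coeff 6 = 0 := by
    intro f hf
    obtain ⟨p, u, hu, hpu⟩ := hl f hf
    -- Comparing one summand with the sum `t.sum` of all the others uses only the two-term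
    -- no-cancellation lemma.
    obtain ⟨t, rfl⟩ := Multiset.exists_cons_of_mem hf
    have ht : t.sum ∈ localCone (LabelPair 3) := AddSubmonoid.multiset_sum_mem _ _ fun g hg =>
      AddSubmonoid.subset_closure (hl g (Multiset.mem_cons_of_mem hg))
    have hf' : f ∈ localCone (LabelPair 3) := AddSubmonoid.subset_closure ⟨p, u, hu, hpu⟩
    rw [Multiset.sum_cons] at hsum
    have hdvd : ∀ a b, Polynomial.X ^ 6 ∣ restrictLine (affinePoint a b) f ∧
        Polynomial.X ^ 6 ∣ restrictLine (affinePoint a b) t.sum := fun a b => by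
      refine (lowestNonneg_of_mem_localCone _ hf').dvd (lowestNonneg_of_mem_localCone _ ht) ?_
      rw [← map_add, hsum, restrictLine_robinsonPoly]
      exact dvd_mul_right _ _
    have hcoeff : ∀ a b, (restrictLine (affinePoint a b) f).coeff 6 =
        (restrictLine (affinePoint a b) p).coeff 3 ^ 2 * constantCoeff u := fun a b => by
      have h1 := (hdvd a b).1
      rw [hpu, map_mul, map_pow] at h1 ⊢
      rw [← coeff_zero_restrictLine (affinePoint a b) u]
      exact coeff_sq_mul_of_dvd (m := 3) (by rw [coeff_zero_restrictLine]; exact hu.ne') h1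
    -- At a zero of the form, two nonnegative degree-6 coefficients add up to 0, so both vanish, and
    -- with them the cubic part of `p`.
    have hzero : ∀ a b, robinson a b 1 = 0 →
        (restrictLine (affinePoint a b) p).coeff 3 = 0 := fun a b hab => by
      have h1 := lowestNonneg_of_mem_localCone (affinePoint a b) hf' 6 (hdvd a b).1
      have h2 := lowestNonneg_of_mem_localCone (affinePoint a b) ht 6 (hdvd a b).2
      have h3 : (restrictLine (affinePoint a b) f).coeff 6 +
          (restrictLine (affinePoint a b) t.sum).coeff 6 = 0 := by
        rw [← Polynomial.coeff_add, ← map_add, hsum, restrictLine_robinsonPoly, hab]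
        simp
      have h4 : (restrictLine (affinePoint a b) f).coeff 6 = 0 := by linarith
      rw [hcoeff] at h4
      exact pow_eq_zero_iff (two_ne_zero) |>.1 ((mul_eq_zero.1 h4).resolve_right hu.ne')
    have hdiff := second_difference_eq_zero p
    simp only [hzero 1 1 (by norm_num [robinson]), hzero 1 (-1) (by norm_num [robinson]),
      hzero (-1) 1 (by norm_num [robinson]), hzero (-1) (-1) (by norm_num [robinson]),
      hzero 1 0 (by norm_num [robinson]), hzero (-1) 0 (by norm_num [robinson]),
      hzero 0 1 (by norm_num [robinson]), hzero 0 (-1) (by norm_num [robinson])] at hdiff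
    have h0 : (restrictLine (affinePoint 0 0) p).coeff 3 = 0 := by linarith
    rw [hcoeff, h0]
    simp
  have h1 : (restrictLine (affinePoint 0 0) robinsonPoly).coeff 6 = 1 := by
    rw [restrictLine_robinsonPoly, show robinson (0 : ℝ) 0 1 = 1 by norm_num [robinson]]
    simp
  have h2 : ∀ s : Multiset (MvPolynomial (LabelPair 3) ℝ),
      (∀ f ∈ s, (restrictLine (affinePoint 0 0) f).coeff 6 = 0) →
      (restrictLine (affinePoint 0 0) s.sum).coeff 6 = 0 := by
    intro s
    induction s using Multiset.induction_on with
    | empty => simp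
    | cons f s ih =>
      intro hs
      rw [Multiset.sum_cons, map_add, Polynomial.coeff_add, hs f (Multiset.mem_cons_self f s),
        ih fun g hg => hs g (Multiset.mem_cons_of_mem hg), add_zero]
  rw [← hsum, h2 l key] at h1
  exact zero_ne_one h1

theorem mul_mem_localCone {σ : Type*} {f u : MvPolynomial σ ℝ} (hf : IsSumSq f)
    (hu : 0 < constantCoeff u) : f * u ∈ localCone σ := by
  induction hf with
  | zero => rw [zero_mul]; exact zero_mem _
  | sq_add a _ ih =>
    rw [add_mul]
    exact add_mem (AddSubmonoid.subset_closure ⟨a, u, hu, by ring⟩) ih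

/-- Each factor takes the value `d` at the origin. -/
theorem constantCoeff_box_pos {σ ι : Type*} {d : ℝ} (hd : 0 < d) (y : ι → MvPolynomial σ ℝ)
    (hy : ∀ i, constantCoeff (y i) = 0) (s : Finset (ι ⊕ ι)) :
    0 < constantCoeff (∏ i ∈ s,
      Sum.elim (fun i => algebraMap ℝ _ d + y i) (fun i => algebraMap ℝ _ d - y i) i) := by
  rw [map_prod]
  refine Finset.prod_pos fun i _ => ?_
  rcases i with i | i <;> simpa [hy]

theorem boxPO_subset_localCone {σ ι : Type*} [Fintype ι] {d : ℝ} (hd : 0 < d)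
    (y : ι → MvPolynomial σ ℝ) (hy : ∀ i, constantCoeff (y i) = 0) {f : MvPolynomial σ ℝ}
    (hf : f ∈ boxPO d y) : f ∈ localCone σ := by
  obtain ⟨τ, hτ, rfl⟩ := hf
  exact sum_mem fun s _ => mul_mem_localCone (hτ s) (constantCoeff_box_pos hd y hy s)

theorem robinsonPoly_notMem_boxPO {d : ℝ} (hd : 0 < d) :
    robinsonPoly ∉ boxPO d (X : LabelPair 3 → MvPolynomial (LabelPair 3) ℝ) := fun h =>
  robinsonPoly_notMem_localCone (boxPO_subset_localCone hd X (by simp) h)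

theorem not_isSumSq_robinsonPoly : ¬ IsSumSq robinsonPoly := fun h =>
  -- Sums of squares lie in every preorder, so any box serves.
  robinsonPoly_notMem_boxPO one_pos (PO.sumSq_mem _ h)

end Multivariate

/-! ## Positive functionals with bounded moments are nonnegative on box preorders -/

section Moments

variable {A ι : Type*} [CommRing A] [Algebra ℝ A]

theorem cauchySchwarz_of_nonneg_mul_self {L : A →ₗ[ℝ] ℝ} (hL : ∀ p, 0 ≤ L (p * p)) (p q : A) :
    L (p * q) ^ 2 ≤ L (p * p) * L (q * q) := by
  have h : ∀ t : ℝ, 0 ≤ L (q * q) * (t * t) + 2 * L (p * q) * t + L (p * p) := fun t => by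
    have h1 : (p + t • q) * (p + t • q) = p * p + (2 * t) • (p * q) + (t * t) • (q * q) := by
      simp only [Algebra.smul_def, map_mul, map_ofNat]
      ring
    have h2 := hL (p + t • q)
    rw [h1, map_add, map_add, map_smul, map_smul, smul_eq_mul, smul_eq_mul] at h2
    linarith
  have h2 := discrim_le_zero h
  rw [discrim] at h2
  linarith

/-- If the even moments of `z` grow at most like those of a measure on `[-d, d]`, then `z` is
bounded by `d` with respect to the positive functional `L`. -/
theorem abs_apply_mul_le {L : A →ₗ[ℝ] ℝ} (hL : ∀ p, 0 ≤ L (p * p)) {d : ℝ} (hd : 0 < d) {z : A}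
    {C : ℝ} (hC : ∀ m : ℕ, L (z ^ m * z ^ m) ≤ C * d ^ (2 * m)) (p : A) :
    |L (p * p * z)| ≤ d * L (p * p) := by
  set s := L (p * p) with hs
  have h1 : ∀ n : ℕ, L (p * p * z ^ n) ^ 2 ≤ s * L (p * p * z ^ (2 * n)) := fun n => by
    have := cauchySchwarz_of_nonneg_mul_self hL p (p * z ^ n)
    convert this using 3 <;> ring_nf
  have h2 : ∀ n : ℕ, L (p * p * z ^ n) ^ 2 ≤ L (p * p * (p * p)) * (C * d ^ (2 * n)) := fun n =>
    (cauchySchwarz_of_nonneg_mul_self hL (p * p) (z ^ n)).trans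
      (mul_le_mul_of_nonneg_left (hC n) (hL _))
  -- If `L(p²) = 0`, Cauchy–Schwarz alone gives `L(p² z) = 0`; otherwise one may divide by `L(p²)`.
  rcases (hL p).eq_or_lt with h0 | hpos
  · have := h1 1
    rw [hs, ← h0, zero_mul, pow_one] at this
    have h3 : L (p * p * z) = 0 := pow_eq_zero_iff two_ne_zero |>.1
      (le_antisymm this (sq_nonneg _))
    rw [hs, h3, ← h0]
    simp
  rw [← hs] at hpos
  by_contra! hlt
  -- After this normalization `b n ^ 2 ≤ b (2n)` while `b` is bounded; `b 1 > 1` would make `b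
  -- (2^n)` unbounded.
  set b : ℕ → ℝ := fun n => |L (p * p * z ^ n)| / (s * d ^ n) with hb
  have hb0 : ∀ n, 0 ≤ b n := fun n => by positivity
  have hb1 : ∀ n, b n ^ 2 ≤ b (2 * n) := fun n => by
    simp only [hb]
    rw [div_pow, sq_abs, div_le_div_iff₀ (by positivity) (by positivity)]
    have h3 : s * L (p * p * z ^ (2 * n)) ≤ s * |L (p * p * z ^ (2 * n))| :=
      mul_le_mul_of_nonneg_left (le_abs_self _) hpos.le
    calc L (p * p * z ^ n) ^ 2 * (s * d ^ (2 * n))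
        ≤ (s * |L (p * p * z ^ (2 * n))|) * (s * d ^ (2 * n)) :=
          mul_le_mul_of_nonneg_right ((h1 n).trans h3) (by positivity)
      _ = |L (p * p * z ^ (2 * n))| * (s * d ^ n) ^ 2 := by ring
  have hb2 : ∀ n, b n ^ 2 ≤ L (p * p * (p * p)) * C / s ^ 2 := fun n => by
    simp only [hb]
    rw [div_pow, sq_abs, div_le_div_iff₀ (by positivity) (by positivity)]
    calc L (p * p * z ^ n) ^ 2 * s ^ 2
        ≤ (L (p * p * (p * p)) * (C * d ^ (2 * n))) * s ^ 2 :=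
          mul_le_mul_of_nonneg_right (h2 n) (by positivity)
      _ = L (p * p * (p * p)) * C * (s * d ^ n) ^ 2 := by ring
  have hb3 : ∀ n : ℕ, b 1 ^ (2 ^ n) ≤ b (2 ^ n) := by
    intro n
    induction n with
    | zero => simp
    | succ n ih =>
      rw [pow_succ 2 n, pow_mul, mul_comm (2 ^ n) 2]
      exact (pow_le_pow_left₀ (pow_nonneg (hb0 1) _) ih 2).trans (hb1 _)
  have hb4 : 1 < b 1 := by
    simp only [hb, pow_one]
    rw [one_lt_div (by positivity)]
    linarith
  obtain ⟨n, hn⟩ := pow_unbounded_of_one_lt (L (p * p * (p * p)) * C / s ^ 2) hb4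
  have h5 : b 1 ^ n ≤ b (2 ^ n) :=
    (pow_le_pow_right₀ hb4.le Nat.lt_two_pow_self.le).trans (hb3 n)
  have h6 : 1 ≤ b (2 ^ n) := (one_le_pow₀ hb4.le).trans h5
  have h7 := hb2 (2 ^ n)
  nlinarith

/-- Positivity on squares, and even moments of the `zᵢ` that grow at most like those of a measure
on the box with side `[-d, d]`. -/
structure BoxFunctional (L : A →ₗ[ℝ] ℝ) (d : ℝ) (z : ι → A) : Prop where
  nonneg : ∀ p, 0 ≤ L (p * p)
  moments : ∀ i, ∃ C, ∀ m : ℕ, L (z i ^ m * z i ^ m) ≤ C * d ^ (2 * m)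

/-- From `|L(p² z)| ≤ d L(p²)`, the new functional is nonnegative on squares and at most `2d` times
the old one there, so only the moment constant changes. The cases `c = ±1` are the two sides of the
box. -/
theorem BoxFunctional.twist {L : A →ₗ[ℝ] ℝ} {d : ℝ} (hd : 0 < d) {z : ι → A}
    (h : BoxFunctional L d z) (i : ι) {c : ℝ} (hc : |c| = 1) :
    BoxFunctional (L ∘ₗ LinearMap.mulRight ℝ (algebraMap ℝ A d + c • z i)) d z := by
  have key : ∀ p : A, L (p * p * (algebraMap ℝ A d + c • z i)) =
      d * L (p * p) + c * L (p * p * z i) := fun p => by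
    rw [mul_add, map_add, mul_comm (p * p) (algebraMap ℝ A d), ← Algebra.smul_def,
      mul_smul_comm, map_smul, map_smul, smul_eq_mul, smul_eq_mul]
  have bound : ∀ p : A, |c * L (p * p * z i)| ≤ d * L (p * p) := fun p => by
    obtain ⟨C, hC⟩ := h.moments i
    rw [abs_mul, hc, one_mul]
    exact abs_apply_mul_le h.nonneg hd hC p
  refine ⟨fun p => ?_, fun j => ?_⟩
  · rw [LinearMap.comp_apply, LinearMap.mulRight_apply, key]
    linarith [neg_le_of_abs_le (bound p)]
  · obtain ⟨C, hC⟩ := h.moments j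
    refine ⟨2 * d * C, fun m => ?_⟩
    rw [LinearMap.comp_apply, LinearMap.mulRight_apply, key]
    have h1 := le_of_abs_le (bound (z j ^ m))
    have h2 := mul_le_mul_of_nonneg_left (hC m) hd.le
    linarith

/-- Each factor is absorbed into the functional by a twist; since this changes `L`, the induction
must quantify over all functionals. -/
theorem BoxFunctional.nonneg_mul_prod {d : ℝ} (hd : 0 < d) {z : ι → A} {σ : A} (hσ : IsSumSq σ)
    (s : Finset (ι ⊕ ι)) : ∀ L : A →ₗ[ℝ] ℝ, BoxFunctional L d z → 0 ≤ L (σ * ∏ i ∈ s,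
      Sum.elim (fun i => algebraMap ℝ A d + z i) (fun i => algebraMap ℝ A d - z i) i) := by
  classical
  induction s using Finset.induction_on with
  | empty =>
    intro L hL
    rw [Finset.prod_empty, mul_one]
    induction hσ with
    | zero => simp
    | sq_add a _ ih => rw [map_add]; exact add_nonneg (hL.nonneg a) ih
  | insert i s hi ih =>
    intro L hL
    rw [Finset.prod_insert hi, mul_left_comm, mul_comm]
    rcases i with i | i
    · simpa using ih _ (hL.twist hd i (c := 1) (by simp))
    · simpa [sub_eq_add_neg] using ih _ (hL.twist hd i (c := -1) (by simp))

theorem BoxFunctional.nonneg_of_mem_boxPO [Fintype ι] {L : A →ₗ[ℝ] ℝ} {d : ℝ} (hd : 0 < d)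
    {z : ι → A} (h : BoxFunctional L d z) {f : A} (hf : f ∈ boxPO d z) : 0 ≤ L f := by
  obtain ⟨σ, hσ, rfl⟩ := hf
  rw [map_sum]
  exact Finset.sum_nonneg fun s _ => BoxFunctional.nonneg_mul_prod hd (hσ s) s L h

end Moments

open LabeledMultigraph

/-! ## Graphs without unlabeled vertices -/

/-- The graph with vertices `1, …, k` and edge multiset `s`. -/
def flatGraph {k : ℕ} (s : Multiset (LabelPair k)) : LabeledMultigraph k where
  U := Empty
  edges := s.map fun e => e.1.map Sum.inl
  loopless := by
    intro f hf
    obtain ⟨e, -, rfl⟩ := Multiset.mem_map.1 hf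
    exact not_isDiag_map Sum.inl_injective e.2

namespace GraphClass

variable {k : ℕ}

theorem mk_flatGraph_mul (s t : Multiset (LabelPair k)) :
    mk (flatGraph s) * mk (flatGraph t) = mk (flatGraph (s + t)) := by
  refine Quotient.sound ⟨Equiv.emptySum Empty _, ?_⟩
  simp only [glue, flatGraph, Multiset.map_add, Multiset.map_map]
  congr 1 <;> refine Multiset.map_congr rfl fun e _ => ?_ <;>
    simp [Sym2.map_map] <;> rfl

theorem mk_singleEdge_pow (e : LabelPair k) (m : ℕ) :
    mk (singleEdge e) ^ m = mk (flatGraph (Multiset.replicate m e)) := by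
  induction m with
  | zero => rfl
  | succ m ih =>
    have h : mk (singleEdge e) = mk (flatGraph {e}) := rfl
    rw [pow_succ, ih, h, mk_flatGraph_mul, Multiset.replicate_succ, add_comm,
      Multiset.singleton_add]

theorem mk_ofEdges_eq {U W : Type} [Fintype U] [Fintype W] {E : Multiset (Sym2 U)}
    {E2 : Multiset (Sym2 W)} (hE : ∀ e ∈ E, ¬ e.IsDiag) (hE2 : ∀ e ∈ E2, ¬ e.IsDiag) (σ : U ≃ W)
    (h : E.map (Sym2.map σ) = E2) : mk (ofEdges U E hE) = mk (ofEdges W E2 hE2) := by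
  refine Quotient.sound ⟨σ, ?_⟩
  simp only [ofEdges, ← h, Multiset.map_map]
  refine Multiset.map_congr rfl fun e _ => ?_
  induction e using Sym2.ind with | _ a b => rfl

theorem not_isDiag_of_mem_map_val (s : Multiset (LabelPair k)) :
    ∀ e ∈ s.map Subtype.val, ¬ e.IsDiag := by
  intro e he
  obtain ⟨f, -, rfl⟩ := Multiset.mem_map.1 he
  exact f.2

theorem unlabel_mk_flatGraph (s : Multiset (LabelPair k)) :
    unlabel (mk (flatGraph s)) =
      mk (ofEdges (Fin k) (s.map Subtype.val) (not_isDiag_of_mem_map_val s)) := by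
  refine Quotient.sound ⟨Equiv.sumEmpty (Fin k) Empty, ?_⟩
  simp only [LabeledMultigraph.unlabel, flatGraph, ofEdges, Multiset.map_map]
  refine Multiset.map_congr rfl fun e _ => ?_
  obtain ⟨e, he⟩ := e
  induction e using Sym2.ind with | _ a b => rfl

theorem dipole_mul_singleVertex (m : ℕ) : dipole m * singleVertex =
    mk (ofEdges (Fin 3) (Multiset.replicate m s(0, 1)) (by
      intro e he
      rw [Multiset.eq_of_mem_replicate he]
      decide)) := by
  refine Quotient.sound ⟨finSumFinEquiv (m := 2) (n := 1), ?_⟩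
  simp only [glue, ofEdges, Multiset.map_zero, add_zero, Multiset.map_replicate]
  rfl

/-- The third label, which meets no edge, becomes the isolated vertex. -/
theorem unlabel_pow (e : LabelPair 3) (m : ℕ) :
    unlabel (mk (singleEdge e) ^ m) = dipole m * singleVertex := by
  have h : ∀ e : LabelPair 3, ∃ σ : Equiv.Perm (Fin 3), e.1.map σ = s(0, 1) := by decide
  obtain ⟨σ, hσ⟩ := h e
  rw [mk_singleEdge_pow, unlabel_mk_flatGraph, dipole_mul_singleVertex]
  refine mk_ofEdges_eq _ _ σ ?_
  rw [Multiset.map_replicate, Multiset.map_replicate, hσ]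

/-- Two distinct pairs out of three labels share exactly one label, so some permutation carries them
to the two edges of the standard path. -/
theorem unlabel_pow_four_mul_sq {e f : LabelPair 3} (hef : e ≠ f) :
    unlabel (mk (singleEdge e) ^ 4 * mk (singleEdge f) ^ 2) = pathFourTwo := by
  have h : ∀ e f : LabelPair 3, e ≠ f →
      ∃ σ : Equiv.Perm (Fin 3), e.1.map σ = s(0, 1) ∧ f.1.map σ = s(1, 2) := by decide
  obtain ⟨σ, hσ, hσ2⟩ := h e f hef
  rw [mk_singleEdge_pow, mk_singleEdge_pow, mk_flatGraph_mul, unlabel_mk_flatGraph]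
  refine mk_ofEdges_eq _ _ σ ?_
  rw [Multiset.map_add, Multiset.map_add, Multiset.map_replicate, Multiset.map_replicate,
    Multiset.map_replicate, Multiset.map_replicate, hσ, hσ2]
  rfl

theorem unlabel_triangle :
    unlabel (mk (singleEdge (pair 0 1 (by decide))) ^ 2 *
      mk (singleEdge (pair 0 2 (by decide))) ^ 2 * mk (singleEdge (pair 1 2 (by decide))) ^ 2) =
      doubledTriangle := by
  rw [mk_singleEdge_pow, mk_singleEdge_pow, mk_singleEdge_pow, mk_flatGraph_mul, mk_flatGraph_mul,
    unlabel_mk_flatGraph]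
  refine mk_ofEdges_eq _ _ (Equiv.refl _) ?_
  simp only [Equiv.coe_refl, Sym2.map_id, Multiset.map_id]
  decide

end GraphClass

/-! ## Forgetting the labels -/

/-- Forgetting the labels, as a linear map. -/
def unlabelLin (k : ℕ) : GraphAlg k →ₗ[ℝ] GraphAlg 0 :=
  MonoidAlgebra.mapDomainLinearMap ℝ ℝ GraphClass.unlabel

theorem unlabelLin_apply {k : ℕ} (a : GraphAlg k) :
    unlabelLin k a = MonoidAlgebra.mapDomain GraphClass.unlabel a := rfl

theorem z_eq {k : ℕ} (e : LabelPair k) :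
    z e = MonoidAlgebra.of ℝ (GraphClass k) (GraphClass.mk (singleEdge e)) := rfl

theorem unlabelLin_of {k : ℕ} (G : GraphClass k) :
    unlabelLin k (MonoidAlgebra.of ℝ _ G) = MonoidAlgebra.of ℝ _ G.unlabel := by
  rw [unlabelLin_apply, MonoidAlgebra.of_apply, MonoidAlgebra.of_apply,
    MonoidAlgebra.mapDomain_single]

theorem unlabelLin_z_pow (e : LabelPair 3) (m : ℕ) : unlabelLin 3 (z e ^ m) =
    MonoidAlgebra.of ℝ _ (GraphClass.dipole m * GraphClass.singleVertex) := by
  rw [z_eq, ← map_pow, unlabelLin_of, GraphClass.unlabel_pow]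

theorem unlabelLin_path {e f : LabelPair 3} (hef : e ≠ f) : unlabelLin 3 (z e ^ 4 * z f ^ 2) =
    MonoidAlgebra.of ℝ _ GraphClass.pathFourTwo := by
  rw [z_eq, z_eq, ← map_pow, ← map_pow, ← map_mul, unlabelLin_of,
    GraphClass.unlabel_pow_four_mul_sq hef]

theorem unlabelLin_triangle : unlabelLin 3 (z (pair 0 1 (by decide)) ^ 2 *
    z (pair 0 2 (by decide)) ^ 2 * z (pair 1 2 (by decide)) ^ 2) =
    MonoidAlgebra.of ℝ _ GraphClass.doubledTriangle := by
  rw [z_eq, z_eq, z_eq, ← map_pow, ← map_pow, ← map_pow, ← map_mul, ← map_mul, unlabelLin_of,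
    GraphClass.unlabel_triangle]

theorem coe_robinsonElement : (robinsonElement : GraphAlg 3) = robinson
    (z (pair 0 1 (by decide))) (z (pair 0 2 (by decide))) (z (pair 1 2 (by decide))) := by
  rw [robinsonElement, aeval_robinsonPoly]
  exact map_robinson (flatAlg 3).val.toRingHom _ _ _

theorem unlabelLin_robinsonElement : unlabelLin 3 (robinsonElement : GraphAlg 3) =
    (3 : ℝ) • MonoidAlgebra.of ℝ _ (GraphClass.dipole 6 * GraphClass.singleVertex) +
    (3 : ℝ) • MonoidAlgebra.of ℝ _ GraphClass.doubledTriangle -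
    (6 : ℝ) • MonoidAlgebra.of ℝ _ GraphClass.pathFourTwo := by
  rw [coe_robinsonElement]
  set x := z (pair 0 1 (by decide)) with hx
  set y := z (pair 0 2 (by decide)) with hy
  set w := z (pair 1 2 (by decide)) with hw
  -- Fourth powers are written first, as `unlabelLin_path` expects.
  have h : robinson x y w = x ^ 6 + y ^ 6 + w ^ 6 - (x ^ 4 * y ^ 2 + x ^ 4 * w ^ 2 + y ^ 4 * x ^ 2
      + y ^ 4 * w ^ 2 + w ^ 4 * x ^ 2 + w ^ 4 * y ^ 2) + (3 : ℝ) • (x ^ 2 * y ^ 2 * w ^ 2) := by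
    rw [robinson, Algebra.smul_def, map_ofNat]
    ring
  rw [h]
  simp only [map_add, map_sub, map_smul]
  rw [hx, hy, hw, unlabelLin_triangle, unlabelLin_z_pow, unlabelLin_z_pow, unlabelLin_z_pow,
    unlabelLin_path (by decide), unlabelLin_path (by decide), unlabelLin_path (by decide),
    unlabelLin_path (by decide), unlabelLin_path (by decide), unlabelLin_path (by decide)]
  module

theorem robinsonGraph_eq : robinsonGraph = MonoidAlgebra.of ℝ _ (GraphClass.dipole 6) +
    MonoidAlgebra.of ℝ _ GraphClass.doubledTriangle -
    (2 : ℝ) • MonoidAlgebra.of ℝ _ GraphClass.pathFourTwo := by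
  simp only [robinsonGraph, MonoidAlgebra.of_apply, MonoidAlgebra.smul_single, smul_eq_mul, mul_one]

theorem coincide_robinson : Coincide ((3 : ℝ) • robinsonGraph) (robinsonElement : GraphAlg 3) := by
  rw [Coincide, AgreeUpToIsolated, ← unlabelLin_apply, unlabelLin_robinsonElement, robinsonGraph_eq]
  -- The two sides differ only by three copies of one relation, that of the dipole with six edges.
  have h := Submodule.smul_mem _ (-3 : ℝ) (Submodule.subset_span (R := ℝ) (Set.mem_range_self
    (f := fun F : GraphClass 0 => MonoidAlgebra.of ℝ (GraphClass 0) (F * GraphClass.singleVertex) -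
      MonoidAlgebra.of ℝ (GraphClass 0) F) (GraphClass.dipole 6)))
  convert h using 1
  module

/-! ## Graph parameters -/

namespace GraphParam

theorem ext_eq_eval_unlabelLin (t : GraphParam) {k : ℕ} (a : GraphAlg k) :
    t.ext a = t.eval (unlabelLin k a) := by
  rw [ext, eval, unlabelLin_apply, MonoidAlgebra.mapDomain, Finsupp.linearCombination_mapDomain]
  rfl

/-- The linear extension of a graph parameter. -/
def evalLin (t : GraphParam) : GraphAlg 0 →ₗ[ℝ] ℝ :=
  Finsupp.linearCombination ℝ t ∘ₗ (MonoidAlgebra.coeffLinearEquiv ℝ).toLinearMap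

theorem evalLin_apply (t : GraphParam) (a : GraphAlg 0) : t.evalLin a = t.eval a := rfl

theorem eval_of (t : GraphParam) (G : GraphClass 0) : t.eval (MonoidAlgebra.of ℝ _ G) = t G := by
  simp [eval]

theorem IsolateIndifferent.eval_eq {t : GraphParam} (ht : t.IsolateIndifferent) {a b : GraphAlg 0}
    (h : AgreeUpToIsolated a b) : t.eval a = t.eval b := by
  have h2 : a - b ∈ LinearMap.ker t.evalLin := by
    refine (Submodule.span_le.2 ?_) h
    rintro _ ⟨F, rfl⟩
    rw [SetLike.mem_coe, LinearMap.mem_ker, map_sub, evalLin_apply, evalLin_apply, eval_of, eval_of,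
      ht F, sub_self]
  rw [LinearMap.mem_ker, map_sub, sub_eq_zero] at h2
  exact h2

/-- A graph parameter as a functional on `𝒜ₖ⁰`. -/
def flatFunctional (t : GraphParam) (k : ℕ) : flatAlg k →ₗ[ℝ] ℝ :=
  t.evalLin ∘ₗ unlabelLin k ∘ₗ (flatAlg k).val.toLinearMap

theorem flatFunctional_apply (t : GraphParam) {k : ℕ} (a : flatAlg k) :
    t.flatFunctional k a = t.ext (a : GraphAlg k) :=
  (t.ext_eq_eval_unlabelLin _).symm

/-- The element `z^(2m)` unlabels to a dipole with `2m` edges and an isolated vertex, so boundedness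
is the moment condition with constant 1. -/
theorem boxFunctional {t : GraphParam} {d : ℝ} (h1 : t.IsolateIndifferent)
    (h2 : t.FlatlyReflectionPositive) (h3 : t.Bounded d) :
    BoxFunctional (t.flatFunctional 3) d (zFlat (k := 3)) where
  nonneg p := by
    rw [flatFunctional_apply, ← sq]
    exact h2 3 _ p.2
  moments e := ⟨1, fun m => by
    rw [flatFunctional_apply, ← pow_add, ← two_mul, ext_eq_eval_unlabelLin, SubmonoidClass.coe_pow]
    change t.eval (unlabelLin 3 (z e ^ (2 * m))) ≤ _
    rw [unlabelLin_z_pow, eval_of, h1, one_mul]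
    exact le_of_abs_le (h3 _)⟩

theorem eval_robinsonGraph_nonneg {t : GraphParam} {d : ℝ} (hd : 0 < d)
    (h1 : t.IsolateIndifferent) (h2 : t.FlatlyReflectionPositive) (h3 : t.Bounded d) :
    0 ≤ t.eval robinsonGraph := by
  have h4 : 3 * t.eval robinsonGraph = t.flatFunctional 3 robinsonElement := by
    rw [flatFunctional_apply, ext_eq_eval_unlabelLin, unlabelLin_apply,
      ← h1.eval_eq coincide_robinson, ← evalLin_apply, ← evalLin_apply, map_smul, smul_eq_mul]
  have h5 : ∀ ε : ℝ, 0 < ε →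
      0 ≤ t.flatFunctional 3 robinsonElement + ε * t.flatFunctional 3 1 := fun ε hε => by
    have := (boxFunctional h1 h2 h3).nonneg_of_mem_boxPO hd (robinsonElement_add_mem hd hε)
    rwa [map_add, Algebra.algebraMap_eq_smul_one, map_smul, smul_eq_mul] at this
  have h6 : 0 ≤ t.flatFunctional 3 1 := by
    simpa using (boxFunctional h1 h2 h3).nonneg 1
  have h7 : 0 ≤ t.flatFunctional 3 robinsonElement := by
    -- The value at 1 may be zero; dividing by that value plus 1 keeps the perturbation below `δ`.
    refine le_of_forall_pos_le_add fun δ hδ => (h5 (δ / (t.flatFunctional 3 1 + 1))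
      (by positivity)).trans ?_
    gcongr
    rw [div_mul_eq_mul_div, div_le_iff₀ (by positivity)]
    nlinarith
  linarith

end GraphParam

section Densities

open MvPolynomial


theorem GraphClass.exists_eq_mk {k : ℕ} (G : GraphClass k) : ∃ F, G = GraphClass.mk F :=
  ⟨Quotient.out G, (Quotient.out_eq G).symm⟩

/-! ## Densities of partially labeled graphs in the weighted complete graph on three vertices -/

/-- The variable of a pair of vertices, zero on the diagonal. -/
def edgeVar (e : Sym2 (Fin 3)) : MvPolynomial (LabelPair 3) ℝ :=
  if h : e.IsDiag then 0 else X ⟨e, h⟩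

theorem constantCoeff_edgeVar (e : Sym2 (Fin 3)) : constantCoeff (edgeVar e) = 0 := by
  unfold edgeVar
  split_ifs <;> simp

open Classical in
/-- The average over all maps from `U` to a set with three elements. -/
def average (U : Type) [Fintype U]
    (g : (U → Fin 3) → MvPolynomial (LabelPair 3) ℝ) : MvPolynomial (LabelPair 3) ℝ :=
  C (1 / 3) ^ Fintype.card U * ∑ φ : U → Fin 3, g φ

theorem average_equiv {U W : Type} [Fintype U] [Fintype W] (σ : U ≃ W)
    (g : (U → Fin 3) → MvPolynomial (LabelPair 3) ℝ) :
    average U g = average W fun φ => g (φ ∘ σ) := by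
  classical
  rw [average, average, Fintype.card_congr σ]
  congr 1
  exact Fintype.sum_equiv (Equiv.arrowCongr σ (Equiv.refl _)) _ _ fun φ => by
    congr 1
    ext v
    simp

theorem average_sum {U W : Type} [Fintype U] [Fintype W]
    (g : (U ⊕ W → Fin 3) → MvPolynomial (LabelPair 3) ℝ) :
    average (U ⊕ W) g = average U fun φ => average W fun χ => g (Sum.elim φ χ) := by
  classical
  simp only [average]
  rw [← Finset.mul_sum, ← mul_assoc, Fintype.card_sum, pow_add,
    ← Fintype.sum_prod_type' fun φ χ => g (Sum.elim φ χ)]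
  have h := Fintype.sum_equiv (Equiv.sumArrowEquivProdArrow U W (Fin 3)) g
    (fun x => g (Sum.elim x.1 x.2)) fun φ => congrArg g (by ext (v | v) <;> rfl)
  rw [← h]
  congr!

theorem average_mul_average {U W : Type} [Fintype U] [Fintype W]
    (f : (U → Fin 3) → MvPolynomial (LabelPair 3) ℝ)
    (g : (W → Fin 3) → MvPolynomial (LabelPair 3) ℝ) :
    average U f * average W g = average U fun φ => average W fun χ => f φ * g χ := by
  classical
  simp only [average, ← Finset.mul_sum, ← Finset.sum_mul]
  ring

theorem average_const (U : Type) [Fintype U] (c : MvPolynomial (LabelPair 3) ℝ) :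
    average U (fun _ => c) = c := by
  have h : (C (1 / 3) * 3 : MvPolynomial (LabelPair 3) ℝ) = 1 := by
    rw [← map_ofNat C 3, ← map_mul]
    norm_num
  simp only [average, Finset.sum_const, Finset.card_univ, Fintype.card_fun, Fintype.card_fin,
    nsmul_eq_mul, Nat.cast_pow, Nat.cast_ofNat]
  rw [← mul_assoc, ← mul_pow, h, one_pow, one_mul]

theorem average_of_isEmpty {U : Type} [Fintype U] [IsEmpty U]
    (g : (U → Fin 3) → MvPolynomial (LabelPair 3) ℝ) (φ : U → Fin 3) : average U g = g φ := by
  rw [← average_const U (g φ)]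
  congr 1
  ext1 χ
  rw [Subsingleton.elim χ φ]

/-- The density of `F` with uniform vertex weights, where the label `i` is mapped to `ψ i`. -/
def labelDensity {k : ℕ} (ψ : Fin k → Fin 3) (F : LabeledMultigraph k) :
    MvPolynomial (LabelPair 3) ℝ :=
  average F.U fun φ => (F.edges.map fun e => edgeVar (e.map (Sum.elim ψ φ))).prod

theorem labelDensity_congr {k : ℕ} (ψ : Fin k → Fin 3) {F G : LabeledMultigraph k} (h : Iso F G) :
    labelDensity ψ F = labelDensity ψ G := by
  obtain ⟨σ, hσ⟩ := h
  rw [labelDensity, labelDensity, average_equiv σ]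
  congr 1
  ext1 φ
  rw [← hσ, Multiset.map_map]
  congr 1
  refine Multiset.map_congr rfl fun e _ => ?_
  rw [Function.comp_apply, Sym2.map_map]
  congr 2
  ext (v | v) <;> simp

/-- Once `ψ` fixes the images of the labels, the unlabeled vertices of the two factors are placed
independently, and the average factors. -/
theorem labelDensity_glue {k : ℕ} (ψ : Fin k → Fin 3) (F G : LabeledMultigraph k) :
    labelDensity ψ (glue F G) = labelDensity ψ F * labelDensity ψ G := by
  rw [labelDensity, labelDensity, labelDensity, average_mul_average]
  refine (average_sum (U := F.U) (W := G.U) _).trans ?_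
  congr! 4 with φ χ
  simp only [glue, Multiset.map_add, Multiset.prod_add, Multiset.map_map]
  congr 2 <;> refine Multiset.map_congr rfl fun e _ => ?_ <;>
    rw [Function.comp_apply, Sym2.map_map] <;> congr 2 <;> ext (v | v) <;> simp

/-- The density of partially labeled graphs is multiplicative. -/
def labelDensityHom {k : ℕ} (ψ : Fin k → Fin 3) :
    GraphClass k →* MvPolynomial (LabelPair 3) ℝ where
  toFun := Quotient.lift (labelDensity ψ) fun _ _ h => labelDensity_congr ψ h
  map_one' := by
    change labelDensity ψ (edgeless k) = 1
    exact average_const Empty 1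
  map_mul' F G := by
    induction F using Quotient.inductionOn with | _ F => ?_
    induction G using Quotient.inductionOn with | _ G => ?_
    exact labelDensity_glue ψ F G

/-- The linear extension of the density to the graph algebra. -/
def densityHom {k : ℕ} (ψ : Fin k → Fin 3) : GraphAlg k →ₐ[ℝ] MvPolynomial (LabelPair 3) ℝ :=
  MonoidAlgebra.lift ℝ _ _ (labelDensityHom ψ)

theorem densityHom_of {k : ℕ} (ψ : Fin k → Fin 3) (F : LabeledMultigraph k) :
    densityHom ψ (MonoidAlgebra.of ℝ _ (GraphClass.mk F)) = labelDensity ψ F :=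
  MonoidAlgebra.lift_of _ _

/-- The image is a variable, or 0 when `ψ` merges the two labels; either way it vanishes at the
origin. -/
theorem densityHom_z {k : ℕ} (ψ : Fin k → Fin 3) (e : LabelPair k) :
    densityHom ψ (z e) = edgeVar (e.1.map ψ) := by
  have h : densityHom ψ (z e) = labelDensity ψ (singleEdge e) := densityHom_of ψ _
  rw [h, labelDensity]
  refine (average_of_isEmpty (U := Empty) _ Empty.elim).trans ?_
  simp only [singleEdge, Multiset.map_singleton, Multiset.prod_singleton, Sym2.map_map]
  rfl

theorem labelDensity_eq_average (ψ₀ : Fin 0 → Fin 3) (F : LabeledMultigraph 0) :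
    labelDensity ψ₀ F = average F.V fun φ => (F.edges.map fun e => edgeVar (e.map φ)).prod := by
  rw [average_sum]
  rw [average_of_isEmpty _ ψ₀]
  rw [labelDensity]

/-- Averaging over all vertices means averaging first over the placements of the former labels, then
over the rest. -/
theorem labelDensity_unlabel {k : ℕ} (ψ₀ : Fin 0 → Fin 3) (F : LabeledMultigraph k) :
    labelDensity ψ₀ F.unlabel = C (1 / 3) ^ k * ∑ ψ : Fin k → Fin 3, labelDensity ψ F := by
  have h : labelDensity ψ₀ F.unlabel = average (Fin k) fun ψ => labelDensity ψ F := by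
    have h2 : ∀ φ : F.V → Fin 3,
        (F.unlabel.edges.map fun e => edgeVar (e.map (Sum.elim ψ₀ φ))).prod =
        (F.edges.map fun e => edgeVar (e.map φ)).prod := fun φ => by
      simp only [LabeledMultigraph.unlabel, Multiset.map_map]
      refine congrArg Multiset.prod (Multiset.map_congr rfl fun e _ => ?_)
      rw [Function.comp_apply, Sym2.map_map]
      rfl
    have h3 : labelDensity ψ₀ F.unlabel =
        average F.V fun φ => (F.edges.map fun e => edgeVar (e.map φ)).prod :=
      congrArg (average F.V) (funext h2)
    exact h3.trans (average_sum _)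
  rw [h, average, Fintype.card_fin]
  exact congrArg _ (Finset.sum_congr (by congr!) fun _ _ => rfl)

theorem densityHom_unlabelLin {k : ℕ} (ψ₀ : Fin 0 → Fin 3) (a : GraphAlg k) :
    densityHom ψ₀ (unlabelLin k a) = C (1 / 3) ^ k * ∑ ψ : Fin k → Fin 3, densityHom ψ a := by
  induction a using MonoidAlgebra.induction_on with
  | of G =>
    obtain ⟨F, rfl⟩ := G.exists_eq_mk
    rw [unlabelLin_of]
    simp only [densityHom_of]
    exact (densityHom_of ψ₀ F.unlabel).trans (labelDensity_unlabel ψ₀ F)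
  | add a b ha hb => simp only [map_add, ha, hb, Finset.sum_add_distrib, mul_add]
  | smul r a ha => simp only [map_smul, ha, ← Finset.smul_sum, mul_smul_comm]

theorem densityHom_singleVertex (ψ₀ : Fin 0 → Fin 3) :
    densityHom ψ₀ (MonoidAlgebra.of ℝ _ GraphClass.singleVertex) = 1 := by
  rw [GraphClass.singleVertex, densityHom_of]
  exact average_const (Fin 1) 1

theorem densityHom_eq_of_agreeUpToIsolated (ψ₀ : Fin 0 → Fin 3) {a b : GraphAlg 0}
    (h : AgreeUpToIsolated a b) : densityHom ψ₀ a = densityHom ψ₀ b := by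
  have h2 : a - b ∈ LinearMap.ker (densityHom ψ₀).toLinearMap := by
    refine (Submodule.span_le.2 ?_) h
    rintro _ ⟨F, rfl⟩
    rw [SetLike.mem_coe, LinearMap.mem_ker, AlgHom.toLinearMap_apply, map_sub, map_mul, map_mul,
      densityHom_singleVertex, mul_one, sub_self]
  rwa [LinearMap.mem_ker, AlgHom.toLinearMap_apply, map_sub, sub_eq_zero] at h2

theorem densityHom_eq_of_coincide (ψ₀ : Fin 0 → Fin 3) {k : ℕ} {a : GraphAlg 0} {σ : GraphAlg k}
    (h : Coincide a σ) :
    densityHom ψ₀ a = C (1 / 3) ^ k * ∑ ψ : Fin k → Fin 3, densityHom ψ σ := by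
  rw [densityHom_eq_of_agreeUpToIsolated ψ₀ h, ← unlabelLin_apply, densityHom_unlabelLin]

/-! ### The density of the Robinson quantum multigraph. -/

theorem sum_arrow_fin_succ {α M : Type*} [Fintype α] [AddCommMonoid M] {n : ℕ}
    (f : (Fin (n + 1) → α) → M) : ∑ φ, f φ = ∑ a : α, ∑ φ : Fin n → α, f (Fin.cons a φ) := by
  rw [← Fintype.sum_prod_type' fun a φ => f (Fin.cons a φ)]
  exact (Fintype.sum_equiv (Fin.consEquiv fun _ => α) _ _ fun φ => rfl).symm

theorem edgeVar_swap (i j : Fin 3) : edgeVar s(i, j) = edgeVar s(j, i) := by rw [Sym2.eq_swap]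

theorem edgeVar_diag (i : Fin 3) : edgeVar s(i, i) = 0 := dif_pos rfl

theorem robinsonPoly_eq : robinsonPoly = robinson (edgeVar s(0, 1)) (edgeVar s(0, 2))
    (edgeVar s(1, 2)) := by
  have h := aeval_robinsonPoly (X : LabelPair 3 → MvPolynomial (LabelPair 3) ℝ)
  rw [aeval_X_left_apply] at h
  exact h

/-- Of the 27 placements of three labels, the six bijections each give `R`, by symmetry. The others
give 0, since loops have weight 0 and `R(0, y, y) = 0`. Dividing `6/27` by the factor 3 in
`coincide_robinson` leaves `2/27`. -/
theorem densityHom_robinsonGraph (ψ₀ : Fin 0 → Fin 3) :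
    densityHom ψ₀ robinsonGraph = (2 / 27 : ℝ) • robinsonPoly := by
  have h1 := densityHom_eq_of_coincide ψ₀ coincide_robinson
  have h2 : ∀ ψ : Fin 3 → Fin 3, densityHom ψ (robinsonElement : GraphAlg 3) =
      robinson (edgeVar s(ψ 0, ψ 1)) (edgeVar s(ψ 0, ψ 2)) (edgeVar s(ψ 1, ψ 2)) := fun ψ => by
    rw [coe_robinsonElement]
    refine (map_robinson (densityHom ψ).toRingHom _ _ _).trans ?_
    change robinson (densityHom ψ _) (densityHom ψ _) (densityHom ψ _) = _
    simp only [densityHom_z, pair, Sym2.map_mk]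
  have h3 : ∑ ψ : Fin 3 → Fin 3, densityHom ψ (robinsonElement : GraphAlg 3) =
      6 * robinsonPoly := by
    have h4 : ∑ ψ : Fin 3 → Fin 3, densityHom ψ (robinsonElement : GraphAlg 3) =
        ∑ a : Fin 3, ∑ b : Fin 3, ∑ c : Fin 3,
          robinson (edgeVar s(a, b)) (edgeVar s(a, c)) (edgeVar s(b, c)) := by
      simp only [h2]
      rw [sum_arrow_fin_succ]
      refine Finset.sum_congr rfl fun a _ => ?_
      rw [sum_arrow_fin_succ]
      refine Finset.sum_congr rfl fun b _ => ?_
      rw [sum_arrow_fin_succ]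
      refine Finset.sum_congr rfl fun c _ => ?_
      rw [Fintype.sum_unique]
      rfl
    rw [h4, robinsonPoly_eq]
    simp only [Fin.sum_univ_three, edgeVar_diag, edgeVar_swap 1 0, edgeVar_swap 2 0,
      edgeVar_swap 2 1, robinson]
    ring
  rw [map_smul, h3] at h1
  have h5 : densityHom ψ₀ robinsonGraph = (1 / 3 : ℝ) • ((3 : ℝ) • densityHom ψ₀ robinsonGraph) := by
    rw [smul_smul]; norm_num
  rw [h5, h1, ← map_pow, ← smul_eq_C_mul, ← map_ofNat C 6, ← smul_eq_C_mul, smul_smul, smul_smul]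
  norm_num

/-! ### Impossibility of preorder representations in graph algebras. -/

theorem isSumSq_map {R S : Type*} [Semiring R] [Semiring S] (f : R →+* S) {x : R}
    (hx : IsSumSq x) : IsSumSq (f x) := by
  induction hx with
  | zero => rw [map_zero]; exact IsSumSq.zero
  | sq_add a _ ih => rw [map_add, map_mul]; exact IsSumSq.sq_add _ ih

theorem map_mem_boxPO {R S ι : Type*} [CommRing R] [CommRing S] [Algebra ℝ R] [Algebra ℝ S]
    [Fintype ι] (f : R →ₐ[ℝ] S) {d : ℝ} {y : ι → R} {x : R} (hx : x ∈ boxPO d y) :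
    f x ∈ boxPO d (fun i => f (y i)) := by
  obtain ⟨σ, hσ, rfl⟩ := hx
  refine ⟨fun s => f (σ s), fun s => isSumSq_map f.toRingHom (hσ s), ?_⟩
  simp only [map_sum, map_mul, map_prod]
  refine Finset.sum_congr rfl fun s _ => congrArg _ (Finset.prod_congr rfl fun i _ => ?_)
  rcases i with i | i <;> simp

theorem C_mul_mem_localCone {σ : Type*} {r : ℝ} (hr : 0 < r) {f : MvPolynomial σ ℝ}
    (hf : f ∈ localCone σ) : C r * f ∈ localCone σ := by
  refine AddSubmonoid.closure_induction ?_ ?_ (fun f g _ _ hf hg => ?_) hf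
  · rintro _ ⟨p, u, hu, rfl⟩
    exact AddSubmonoid.subset_closure ⟨p, C r * u, by simpa using mul_pos hr hu, by ring⟩
  · rw [mul_zero]; exact zero_mem _
  · rw [mul_add]; exact add_mem hf hg

/-- Each density homomorphism maps the preorder into the local cone, which is closed under sums and
positive scalars; a coincidence would thus put `R` into that cone. -/
theorem not_coincide_of_mem_boxPO {d : ℝ} (hd : 0 < d) {k : ℕ} {σ : GraphAlg k}
    (hσ : σ ∈ boxPO d (z (k := k))) : ¬ Coincide robinsonGraph σ := by
  intro h
  have h1 := densityHom_eq_of_coincide Fin.elim0 h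
  rw [densityHom_robinsonGraph] at h1
  have h2 : ∑ ψ : Fin k → Fin 3, densityHom ψ σ ∈ localCone (LabelPair 3) :=
    sum_mem fun ψ _ => boxPO_subset_localCone hd _
      (fun e => by rw [densityHom_z, constantCoeff_edgeVar]) (map_mem_boxPO (densityHom ψ) hσ)
  have h3 : robinsonPoly = C (27 / 2) * ((2 / 27 : ℝ) • robinsonPoly) := by
    rw [← smul_eq_C_mul, smul_smul]; norm_num
  apply robinsonPoly_notMem_localCone
  rw [h3, h1, ← map_pow]
  exact C_mul_mem_localCone (by norm_num) (C_mul_mem_localCone (by positivity) h2)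

theorem not_coincide_of_mem_boxPO_flat {d : ℝ} (hd : 0 < d) {k : ℕ} {σ : flatAlg k}
    (hσ : σ ∈ boxPO d (zFlat (k := k))) : ¬ Coincide robinsonGraph (σ : GraphAlg k) := by
  have h := map_mem_boxPO (flatAlg k).val hσ
  exact not_coincide_of_mem_boxPO hd h

/-! ## The substitution in `t̃` -/

theorem subst_algebraMap (p : WeightPoly 3) :
    subst (algebraMap (WeightPoly 3) _ p) = substPoly p :=
  IsLocalization.Away.lift_eq _ _ _

theorem subst_invSelf : subst (IsLocalization.Away.invSelf (weightSum 3)) = 1 := by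
  have h := congrArg subst (IsLocalization.Away.mul_invSelf
    (S := Localization.Away (weightSum 3)) (weightSum 3))
  rwa [map_mul, subst_algebraMap, substPoly_weightSum, one_mul, map_one] at h

theorem subst_smul (r : ℝ) (x : Localization.Away (weightSum 3)) :
    subst (r • x) = r • subst x := by
  rw [Algebra.smul_def, map_mul, IsScalarTower.algebraMap_apply ℝ (WeightPoly 3),
    subst_algebraMap, AlgHom.commutes, ← Algebra.smul_def]

theorem substPoly_X_inr (e : Sym2 (Fin 3)) : substPoly (X (Sum.inr e)) = edgeVar e := by
  rw [substPoly, aeval_X]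
  rfl

/-- The substitution sends `g` to 1, and the vertex weights `1/3` supply the normalization of the
uniform average. -/
theorem subst_weightedDensity (ψ₀ : Fin 0 → Fin 3) (F : LabeledMultigraph 0) :
    subst (weightedDensity 3 F) = labelDensity ψ₀ F := by
  rw [labelDensity_eq_average, weightedDensity, map_mul, map_pow, subst_invSelf, one_pow, mul_one,
    subst_algebraMap, weightedCount, map_sum, average, Finset.mul_sum]
  refine Finset.sum_congr (by congr!) fun φ _ => ?_
  rw [map_mul, map_prod, map_multiset_prod, Multiset.map_map]
  congr 1
  · simp [substPoly]
  · simp only [Function.comp_apply, substPoly_X_inr]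

/-- The linear map `t̃(·, 3)`. -/
def tTildeLin : GraphAlg 0 →ₗ[ℝ] Localization.Away (weightSum 3) :=
  Finsupp.linearCombination ℝ (α := GraphClass 0)
    (Quotient.lift (weightedDensity 3) fun _ _ h => weightedDensity_congr 3 h) ∘ₗ
    (MonoidAlgebra.coeffLinearEquiv ℝ).toLinearMap

theorem tTildeLin_of (F : LabeledMultigraph 0) :
    tTildeLin (MonoidAlgebra.of ℝ _ (GraphClass.mk F)) = weightedDensity 3 F :=
  (Finsupp.linearCombination_single ℝ (1 : ℝ) (GraphClass.mk F)).trans (one_smul ℝ _)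

theorem subst_tTilde (ψ₀ : Fin 0 → Fin 3) (a : GraphAlg 0) :
    subst (tTilde 3 a) = densityHom ψ₀ a := by
  change subst (tTildeLin a) = densityHom ψ₀ a
  induction a using MonoidAlgebra.induction_on with
  | of G =>
    obtain ⟨F, rfl⟩ := G.exists_eq_mk
    rw [tTildeLin_of, subst_weightedDensity ψ₀, densityHom_of]
  | add a b ha hb => rw [map_add, map_add, map_add, ha, hb]
  | smul r a ha => rw [map_smul tTildeLin, map_smul (densityHom ψ₀), subst_smul, ha]

theorem subst_tTilde_robinsonGraph :
    ∃ c : ℝ, 0 < c ∧ subst (tTilde 3 robinsonGraph) = c • robinsonPoly :=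
  ⟨2 / 27, by norm_num, by rw [subst_tTilde Fin.elim0, densityHom_robinsonGraph]⟩

end Densities

/-! ## Reduction of the edge multiplicities -/

theorem reduceGraph_ofEdges {U : Type} [Fintype U] (E : Multiset (Sym2 U))
    (hE : ∀ e ∈ E, ¬ e.IsDiag) (H : SimpleGraph U) (h : ∀ v w, H.Adj v w ↔ s(v, w) ∈ E) :
    reduceGraph (ofEdges U E hE) = SimpleClass.mk H := by
  have key : ∀ v w : U, H.Adj v w ↔ (SimpleGraph.fromEdgeSet
      {e : Sym2 (Fin 0 ⊕ U) | e ∈ E.map (Sym2.map Sum.inr)}).Adj (Sum.inr v) (Sum.inr w) := by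
    intro v w
    rw [SimpleGraph.fromEdgeSet_adj, Set.mem_ofPred_eq,
      show s((Sum.inr v : Fin 0 ⊕ U), Sum.inr w) = Sym2.map Sum.inr s(v, w) from rfl,
      Multiset.mem_map_of_injective (Sym2.map.injective Sum.inr_injective), h]
    refine ⟨fun hvw => ⟨hvw, fun heq => hE _ hvw ?_⟩, fun hvw => hvw.1⟩
    rw [Sum.inr_injective heq]
    exact Sym2.mk_isDiag_iff.2 rfl
  refine Quotient.sound ⟨⟨Equiv.emptySum (Fin 0) U, ?_⟩⟩
  rintro (v | v) (w | w)
  · exact v.elim0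
  · exact v.elim0
  · exact w.elim0
  exact key v w

/-- Reduction of the edge multiplicities as a linear map. -/
def reduceLin : GraphAlg 0 →ₗ[ℝ] SimpleQuantumGraph :=
  Finsupp.lmapDomain (α := GraphClass 0) (α' := SimpleClass) ℝ ℝ
    (Quotient.lift reduceGraph fun _ _ h => reduceGraph_congr h) ∘ₗ
    (MonoidAlgebra.coeffLinearEquiv ℝ).toLinearMap

theorem reduceLin_of (F : LabeledMultigraph 0) :
    reduceLin (MonoidAlgebra.of ℝ _ (GraphClass.mk F)) = Finsupp.single (reduceGraph F) 1 :=
  Finsupp.mapDomain_single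

theorem reduce_robinsonGraph : reduce robinsonGraph = SimpleQuantumGraph.trianglePathEdge := by
  change reduceLin robinsonGraph = _
  rw [robinsonGraph_eq, map_sub, map_add, map_smul, GraphClass.dipole, GraphClass.doubledTriangle,
    GraphClass.pathFourTwo, reduceLin_of, reduceLin_of, reduceLin_of,
    reduceGraph_ofEdges _ _ (⊤ : SimpleGraph (Fin 2)) (by decide),
    reduceGraph_ofEdges _ _ (⊤ : SimpleGraph (Fin 3)) (by decide),
    reduceGraph_ofEdges _ _ (SimpleGraph.fromEdgeSet {s(0, 1), s(1, 2)} : SimpleGraph (Fin 3))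
      (by simp only [SimpleGraph.fromEdgeSet_adj, Set.mem_insert_iff, Set.mem_singleton_iff]
          decide),
    Finsupp.smul_single, smul_eq_mul, mul_one, SimpleQuantumGraph.trianglePathEdge]
  abel

/-! ## Homomorphism densities -/

open Classical in
/-- The truth value of a proposition, as a real number. -/
def truthValue (p : Prop) : ℝ := if p then 1 else 0

theorem truthValue_mul (p q : Prop) : truthValue p * truthValue q = truthValue (p ∧ q) := by
  by_cases hp : p <;> by_cases hq : q <;> simp [truthValue, hp, hq]

theorem truthValue_congr {p q : Prop} (h : p ↔ q) : truthValue p = truthValue q :=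
  congrArg truthValue (propext h)

section Density

variable {W : Type} (G : SimpleGraph W)

/-- The real adjacency matrix. -/
def adjReal (a b : W) : ℝ := truthValue (G.Adj a b)

theorem adjReal_comm (a b : W) : adjReal G a b = adjReal G b a :=
  truthValue_congr (G.adj_comm a b)

theorem adjReal_eq_zero_or_one (a b : W) : adjReal G a b = 0 ∨ adjReal G a b = 1 := by
  unfold adjReal truthValue
  split_ifs <;> simp

variable [Fintype W]

theorem card_hom_eq_sum {V : Type} [Fintype V] [DecidableEq V] (H : SimpleGraph V) :
    (Nat.card (H →g G) : ℝ) =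
      ∑ φ : V → W, truthValue (∀ v w, H.Adj v w → G.Adj (φ v) (φ w)) := by
  classical
  have e : (H →g G) ≃ {φ : V → W // ∀ v w, H.Adj v w → G.Adj (φ v) (φ w)} :=
    ⟨fun f => ⟨f, fun _ _ h => f.map_adj h⟩, fun f => ⟨f.1, fun {_ _} h => f.2 _ _ h⟩,
      fun _ => rfl, fun _ => rfl⟩
  rw [Nat.card_congr e, Nat.card_eq_fintype_card, Fintype.card_subtype, Finset.card_filter]
  push_cast
  refine Finset.sum_congr rfl fun φ _ => ?_
  rw [truthValue]
  congr

theorem card_hom_edge : (Nat.card ((⊤ : SimpleGraph (Fin 2)) →g G) : ℝ) =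
    ∑ a, ∑ b, adjReal G a b := by
  rw [card_hom_eq_sum, sum_arrow_fin_succ]
  refine Finset.sum_congr rfl fun a _ => ?_
  rw [sum_arrow_fin_succ]
  refine Finset.sum_congr rfl fun b _ => ?_
  rw [Fintype.sum_unique, adjReal]
  refine truthValue_congr ?_
  simp [Fin.forall_fin_succ, G.adj_comm b a]

theorem card_hom_triangle : (Nat.card ((⊤ : SimpleGraph (Fin 3)) →g G) : ℝ) =
    ∑ a, ∑ b, ∑ c, adjReal G a b * adjReal G a c * adjReal G b c := by
  rw [card_hom_eq_sum, sum_arrow_fin_succ]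
  refine Finset.sum_congr rfl fun a _ => ?_
  rw [sum_arrow_fin_succ]
  refine Finset.sum_congr rfl fun b _ => ?_
  rw [sum_arrow_fin_succ]
  refine Finset.sum_congr rfl fun c _ => ?_
  rw [Fintype.sum_unique, adjReal, adjReal, adjReal, truthValue_mul, truthValue_mul]
  refine truthValue_congr ?_
  simp [Fin.forall_fin_succ, G.adj_comm b a, G.adj_comm c a, G.adj_comm c b]
  tauto

theorem card_hom_path : (Nat.card ((SimpleGraph.fromEdgeSet {s(0, 1), s(1, 2)} :
    SimpleGraph (Fin 3)) →g G) : ℝ) = ∑ a, ∑ b, ∑ c, adjReal G a b * adjReal G b c := by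
  rw [card_hom_eq_sum, sum_arrow_fin_succ]
  refine Finset.sum_congr rfl fun a _ => ?_
  rw [sum_arrow_fin_succ]
  refine Finset.sum_congr rfl fun b _ => ?_
  rw [sum_arrow_fin_succ]
  refine Finset.sum_congr rfl fun c _ => ?_
  rw [Fintype.sum_unique, adjReal, adjReal, truthValue_mul]
  refine truthValue_congr ?_
  simp [Fin.forall_fin_succ, G.adj_comm b a, G.adj_comm c b]

theorem card_hom_two_edges : (Nat.card ((SimpleGraph.fromEdgeSet {s(0, 1), s(2, 3)} :
    SimpleGraph (Fin 4)) →g G) : ℝ) = (∑ a, ∑ b, adjReal G a b) ^ 2 := by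
  have h : (∑ a, ∑ b, adjReal G a b) ^ 2 =
      ∑ a, ∑ b, ∑ c, ∑ d, adjReal G a b * adjReal G c d := by
    rw [sq, Finset.sum_mul]
    refine Finset.sum_congr rfl fun a _ => ?_
    rw [Finset.sum_mul]
    refine Finset.sum_congr rfl fun b _ => ?_
    simp only [Finset.mul_sum]
  rw [h, card_hom_eq_sum, sum_arrow_fin_succ]
  refine Finset.sum_congr rfl fun a _ => ?_
  rw [sum_arrow_fin_succ]
  refine Finset.sum_congr rfl fun b _ => ?_
  rw [sum_arrow_fin_succ]
  refine Finset.sum_congr rfl fun c _ => ?_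
  rw [sum_arrow_fin_succ]
  refine Finset.sum_congr rfl fun d _ => ?_
  rw [Fintype.sum_unique, adjReal, adjReal, truthValue_mul]
  refine truthValue_congr ?_
  simp [Fin.forall_fin_succ, G.adj_comm b a, G.adj_comm d c]

theorem path_sum_eq_center_first : ∑ a, ∑ b, ∑ c, adjReal G a b * adjReal G b c =
    ∑ a, ∑ b, ∑ c, adjReal G a b * adjReal G a c := by
  rw [Finset.sum_comm]
  refine Finset.sum_congr rfl fun b _ => Finset.sum_congr rfl fun a _ => ?_
  simp only [adjReal_comm G a b]

theorem path_sum_eq_center_last : ∑ a, ∑ b, ∑ c, adjReal G a b * adjReal G b c =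
    ∑ a, ∑ b, ∑ c, adjReal G a c * adjReal G b c := by
  refine Finset.sum_congr rfl fun a _ => ?_
  rw [Finset.sum_comm]
  refine Finset.sum_congr rfl fun c _ => Finset.sum_congr rfl fun b _ => ?_
  rw [adjReal_comm G b c]

/-- A triple of vertices contributes nonnegatively to the symmetrized count. -/
theorem triple_nonneg {x y w : ℝ} (hx : x = 0 ∨ x = 1) (hy : y = 0 ∨ y = 1) (hw : w = 0 ∨ w = 1) :
    0 ≤ 3 * (x * y * w) - 2 * (x * w + x * y + y * w) + (x + y + w) := by
  rcases hx with rfl | rfl <;> rcases hy with rfl | rfl <;> rcases hw with rfl | rfl <;> norm_num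

/-- Sum `triple_nonneg` over all triples, repetitions included. The three products of two
adjacencies all sum to the path count, the three single adjacencies to `n` times the edge count;
then divide by 3. -/
theorem triangle_path_edge_sum_nonneg :
    0 ≤ ∑ a, ∑ b, ∑ c, adjReal G a b * adjReal G a c * adjReal G b c -
      2 * ∑ a, ∑ b, ∑ c, adjReal G a b * adjReal G b c +
      Fintype.card W * ∑ a, ∑ b, adjReal G a b := by
  have h : 0 ≤ ∑ a, ∑ b, ∑ c, (3 * (adjReal G a b * adjReal G a c * adjReal G b c) -
      2 * (adjReal G a b * adjReal G b c + adjReal G a b * adjReal G a c +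
        adjReal G a c * adjReal G b c) + (adjReal G a b + adjReal G a c + adjReal G b c)) :=
    Finset.sum_nonneg fun a _ => Finset.sum_nonneg fun b _ => Finset.sum_nonneg fun c _ =>
      triple_nonneg (adjReal_eq_zero_or_one G a b) (adjReal_eq_zero_or_one G a c)
        (adjReal_eq_zero_or_one G b c)
  have h1 : ∑ _a : W, ∑ b, ∑ c, adjReal G b c = Fintype.card W * ∑ a, ∑ b, adjReal G a b := by
    rw [Finset.sum_const, Finset.card_univ, nsmul_eq_mul]
  have h2 : ∑ a, ∑ _b : W, ∑ c, adjReal G a c = Fintype.card W * ∑ a, ∑ b, adjReal G a b := by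
    simp only [Finset.sum_const, Finset.card_univ, nsmul_eq_mul, Finset.mul_sum]
  have h3 : ∑ a, ∑ b, ∑ _c : W, adjReal G a b = Fintype.card W * ∑ a, ∑ b, adjReal G a b := by
    simp only [Finset.sum_const, Finset.card_univ, nsmul_eq_mul, Finset.mul_sum]
  have h4 : ∀ f : W → W → W → ℝ, ∀ r : ℝ, ∑ a, ∑ b, ∑ c, r * f a b c =
      r * ∑ a, ∑ b, ∑ c, f a b c := fun f r => by simp only [Finset.mul_sum]
  simp only [Finset.sum_add_distrib, Finset.sum_sub_distrib, h4] at h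
  rw [← path_sum_eq_center_first, ← path_sum_eq_center_last, h1, h2, h3] at h
  linarith

/-- Cauchy–Schwarz for the degree sequence: grouped by the middle vertex, the path count is the sum
of squared degrees. -/
theorem sq_edge_sum_le : (∑ a, ∑ b, adjReal G a b) ^ 2 ≤
    Fintype.card W * ∑ a, ∑ b, ∑ c, adjReal G a b * adjReal G b c := by
  rw [path_sum_eq_center_first]
  simp only [← Finset.mul_sum, ← Finset.sum_mul, ← sq]
  exact sq_sum_le_card_mul_sum_sq

end Density

namespace SimpleQuantumGraph

theorem density_single {V : Type} [Fintype V] (H : SimpleGraph V) (r : ℝ) {W : Type} [Fintype W]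
    (G : SimpleGraph W) : density (Finsupp.single (SimpleClass.mk H) r) G =
      r * ((Nat.card (H →g G) : ℝ) / (Fintype.card W : ℝ) ^ Fintype.card V) :=
  (Finsupp.linearCombination_single ℝ r (SimpleClass.mk H)).trans (smul_eq_mul _ _)

theorem density_add (a b : SimpleQuantumGraph) {W : Type} [Fintype W] (G : SimpleGraph W) :
    density (a + b) G = density a G + density b G :=
  map_add (Finsupp.linearCombination ℝ (α := SimpleClass) _) a b

theorem density_sub (a b : SimpleQuantumGraph) {W : Type} [Fintype W] (G : SimpleGraph W) :
    density (a - b) G = density a G - density b G :=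
  map_sub (Finsupp.linearCombination ℝ (α := SimpleClass) _) a b

theorem nonneg_trianglePathEdge : trianglePathEdge.Nonneg := by
  intro W _ _ G
  have hn : (0 : ℝ) < Fintype.card W := Nat.cast_pos.2 Fintype.card_pos
  rw [trianglePathEdge, density_add, density_sub, density_single, density_single, density_single,
    card_hom_edge, card_hom_triangle, card_hom_path, Fintype.card_fin, Fintype.card_fin]
  have h := triangle_path_edge_sum_nonneg G
  refine (div_nonneg h (pow_nonneg hn.le 3)).trans_eq ?_
  field_simp

/-- Only the middle terms differ, and two disjoint edges have at most the density of a path. -/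
theorem density_goodman_ge {W : Type} [Fintype W] [Nonempty W] (G : SimpleGraph W) :
    trianglePathEdge.density G ≤ goodman.density G := by
  have hn : (0 : ℝ) < Fintype.card W := Nat.cast_pos.2 Fintype.card_pos
  rw [trianglePathEdge, goodman]
  simp only [density_add, density_sub, density_single]
  rw [card_hom_path, card_hom_two_edges]
  simp only [Fintype.card_fin]
  gcongr 1
  gcongr 1
  gcongr 1
  rw [div_le_div_iff₀ (by positivity) (by positivity)]
  calc _ ≤ (Fintype.card W * ∑ a, ∑ b, ∑ c, adjReal G a b * adjReal G b c) *
        (Fintype.card W : ℝ) ^ 3 := mul_le_mul_of_nonneg_right (sq_edge_sum_le G) (by positivity)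
    _ = _ := by ring

theorem nonneg_goodman : goodman.Nonneg := fun W _ _ G =>
  (nonneg_trianglePathEdge W G).trans (density_goodman_ge G)

end SimpleQuantumGraph

end QMG

end

open QMG
theorem mainTheorem6 :
    -- the Robinson quantum multigraph comes from the Robinson polynomial in `𝒜₃⁰`
    Coincide ((3 : ℝ) • robinsonGraph) (robinsonElement : GraphAlg 3) ∧
    -- the Robinson polynomial is nonnegative, but not a sum of squares
    (∀ v : LabelPair 3 → ℝ, 0 ≤ MvPolynomial.eval v robinsonPoly) ∧
    (¬ IsSumSq robinsonPoly) ∧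
    -- `R + ε` lies in the preorder `𝒫₃(d)` of `𝒜₃⁰`
    (∀ d : ℝ, 0 < d → ∀ ε : ℝ, 0 < ε →
      robinsonElement + algebraMap ℝ (flatAlg 3) ε ∈ boxPO d (zFlat (k := 3))) ∧
    -- nonnegativity of the Robinson quantum multigraph
    (∀ d : ℝ, 0 < d → ∀ t : GraphParam, t.IsolateIndifferent → t.FlatlyReflectionPositive →
      t.Bounded d → 0 ≤ t.eval robinsonGraph) ∧
    -- it does not coincide with an element of `PO(d ± z_{ij})` in any `𝒜ₖ`, nor in any `𝒜ₖ⁰`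
    (∀ d : ℝ, 0 < d → ∀ (k : ℕ), ∀ σ ∈ boxPO d (z (k := k)), ¬ Coincide robinsonGraph σ) ∧
    (∀ d : ℝ, 0 < d → ∀ (k : ℕ), ∀ σ ∈ boxPO d (zFlat (k := k)),
      ¬ Coincide robinsonGraph (σ : GraphAlg k)) ∧
    -- `t̃(a, 3)` recovers the Robinson polynomial, which is in no preorder `PO(d ± y_{ij})`
    (∃ c : ℝ, 0 < c ∧ subst (tTilde 3 robinsonGraph) = c • robinsonPoly) ∧
    (∀ d : ℝ, 0 < d →
      robinsonPoly ∉ boxPO d (MvPolynomial.X : LabelPair 3 → MvPolynomial (LabelPair 3) ℝ)) ∧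
    -- reduction of the edge multiplicities, and Goodman's theorem
    reduce robinsonGraph = SimpleQuantumGraph.trianglePathEdge ∧
    SimpleQuantumGraph.trianglePathEdge.Nonneg ∧
    SimpleQuantumGraph.goodman.Nonneg :=
  ⟨coincide_robinson, eval_robinsonPoly_nonneg, not_isSumSq_robinsonPoly,
    fun _ hd _ hε => robinsonElement_add_mem hd hε,
    fun _ hd _ h1 h2 h3 => GraphParam.eval_robinsonGraph_nonneg hd h1 h2 h3,
    fun _ hd _ _ hσ => not_coincide_of_mem_boxPO hd hσ,
    fun _ hd _ _ hσ => not_coincide_of_mem_boxPO_flat hd hσ,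
    subst_tTilde_robinsonGraph, fun _ hd => robinsonPoly_notMem_boxPO hd,
    reduce_robinsonGraph, SimpleQuantumGraph.nonneg_trianglePathEdge,
    SimpleQuantumGraph.nonneg_goodman⟩
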